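/- All Hilbert spaces are complex and finite-dimensional. $\mathcal L(\mathcal K)$ denotes the set of linear operators on $\mathcal K$, $[n]=\{0,\dots,n-1\}$, and $\mathrm{Tr}_{\mathcal E}$ is the partial trace over $\mathcal E$. **Purified channels.** Let $\mathcal H$ be a Hilbert space. A purified $\mathcal H$-channel $[U,|\varepsilon\rangle,\mathcal E]$ consists of an environment Hilbert space $\mathcal E$, a unit vector $|\varepsilon\rangle\in\mathcal E$ and a unitary operator $U$ on $\mathcal H\otimes\mathcal E$. Put $$T^{(1)}=(I_{\mathcal H}\otimes\langle\varepsilon|)\,U\,(I_{\mathcal H}\otimes|\varepsilon\rangle),\qquad U^{(2)}=(I_{\mathcal H}\otimes U)(\mathfrak S\otimes I_{\mathcal E})(I_{\mathcal H}\otimes U),$$ where $\mathfrak S(|\psi_1\rangle\otimes|\psi_2\rangle)=|\psi_2\rangle\otimes|\psi_1\rangle$ is the swap operator on $\mathcal H\otimes\mathcal H$, and $$\mathcal S^{(2)}:\mathcal L(\mathcal H^{\otimes2})\to\mathcal L(\mathcal H^{\otimes2}),\quad \rho\mapsto \mathrm{Tr}_{\mathcal E}\big(U^{(2)}(\rho\otimes|\varepsilon\rangle\langle\varepsilon|)U^{(2)\dagger}\big),\qquad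 T^{(2)}=(I_{\mathcal H^{\otimes2}}\otimes\langle\varepsilon|)\,U^{(2)}\,(I_{\mathcal H^{\otimes2}}\otimes|\varepsilon\rangle).$$ **Diagrams.** Bare PBS-diagrams $D:n$ (with $n\in\mathbb N$ input and $n$ output wires) are generated by the empty diagram $:0$, the wire $:1$, the negation $:1$, the swap $:2$, the polarising beam splitter (PBS) $:2$ and gates $:1$, under sequential composition ($D_2\circ D_1:n$ for $D_1,D_2:n$), parallel composition ($D_1\oplus D_2:n_1+n_2$ for $D_i:n_i$) and trace ($Tr(D):n$ for $D:n+1$); different gates of a diagram carry different names, which form its alphabet $\Gamma$. The word path semantics $(D,c,p)\xRightarrow{w}(c',p')$, with polarisations $c,c'\in\{\rightarrow,\uparrow\}$, positions $p,p'\in[n]$ and $w\in\Gamma^*$, describes the path of a particle: the word is empty on all generators other than gates; the wire changes nothing; the negation exchanges $\rightarrow$ and $\uparrow$; the swap sends $p$ to $1-p$; the PBS fixes $(\rightarrow,p)$ and sends $(\uparrow,p)$ to $(\uparrow,1-p)$; a gate $a$ fixes $(c,0)$ and has the word $a$; $D_2\circ D_1$ runs $D_1$ and then $D_2$ and concatenates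 the two words in this order; $D_1\oplus D_2$ runs $D_1$ on the first $n_1$ positions and $D_2$ on the others; $Tr(D)$ runs $D$ again and again, concatenating the words, as long as the output position is the last one, $n$, which is fed back to the input position $n$. This determines $w,c',p'$ uniquely; write them $w^D_{c,p},c^D_{c,p},p^D_{c,p}$. An extended PBS-diagram is a bare PBS-diagram $D'$ each of whose gates $a\in\Gamma$ is filled with a purified $\mathcal H$-channel $[U_a,|\varepsilon_a\rangle,\mathcal E_a]$. Let $\mathcal E=\bigotimes_{a\in\Gamma}\mathcal E_a$ and $|\varepsilon\rangle=\bigotimes_{a\in\Gamma}|\varepsilon_a\rangle$, let $V_a=U_a\otimes\bigotimes_{x\ne a}I_{\mathcal E_x}$ on $\mathcal H\otimes\mathcal E$, and let $V_{a_1\cdots a_k}=V_{a_k}\cdots V_{a_1}$. The quantum semantics of the extended diagram $D:n$ is the superoperator $$[\![D]\!]:\ \rho\mapsto\mathrm{Tr}_{\mathcal E}\big(U_{D'}(\rho\otimes|\varepsilon\rangle\langle\varepsilon|)U_{D'}^\dagger\big),\qquad U_{D'}=\sum_{c\in\{\rightarrow,\uparrow\},\,p\in[n]}|c^{D'}_{c,p}\rangle\langle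 c|\otimes|p^{D'}_{c,p}\rangle\langle p|\otimes V_{w^{D'}_{c,p}},$$ on $\mathcal L(\mathbb C^{\{\rightarrow,\uparrow\}}\otimes\mathbb C^{[n]}\otimes\mathcal H)$. A context $C[\cdot]$ with $n$ input/output wires is an extended PBS-diagram with $n$ input/output wires in which exactly one gate is left empty (the hole); $C[U,|\varepsilon\rangle,\mathcal E]$ is the extended diagram obtained by filling the hole with $[U,|\varepsilon\rangle,\mathcal E]$. Two purified $\mathcal H$-channels satisfy $[U,|\varepsilon\rangle,\mathcal E]\approx_2[U',|\varepsilon'\rangle,\mathcal E']$ if $[\![C[U,|\varepsilon\rangle,\mathcal E]]\!]=[\![C[U',|\varepsilon'\rangle,\mathcal E']]\!]$ for every context $C[\cdot]$ with one input/output wire. **Theorem.** Let $[U,|\varepsilon\rangle,\mathcal E]$ and $[U',|\varepsilon'\rangle,\mathcal E']$ be purified $\mathcal H$-channels. 1. $[U,|\varepsilon\rangle,\mathcal E]\approx_2[U',|\varepsilon'\rangle,\mathcal E']$ if and only if the two channels have the same first-level transformation matrix $T^{(1)}$, the same second-level superoperator $\mathcal S^{(2)}$ and the same second-level transformation matrix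 $T^{(2)}$. 2. $[U,|\varepsilon\rangle,\mathcal E]\approx_2[U',|\varepsilon'\rangle,\mathcal E']$ if and only if $[\![C[U,|\varepsilon\rangle,\mathcal E]]\!]=[\![C[U',|\varepsilon'\rangle,\mathcal E']]\!]$ for every $n\in\mathbb N$ and every context $C[\cdot]$ with $n$ input/output wires. -/

import Mathlib

open scoped Kronecker

universe u v

/-! ### Bare PBS-diagrams -/

/-- Polarisations: horizontal (`→`) and vertical (`↑`). -/
inductive Pol : Type
  | hor
  | ver
  deriving DecidableEq

namespace Pol

instance : Fintype Pol where
  elems := {hor, ver}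
  complete := fun c => by cases c <;> simp

/-- The polarisation flip. -/
def flip : Pol → Pol
  | hor => ver
  | ver => hor

end Pol

/-- Bare PBS-diagrams `D : n` with `n` input and `n` output wires. The gates carry no explicit
names: the alphabet of `D` is the type `D.Gate` of gate occurrences of `D`, defined below, so that
different gates have different names by construction. -/
inductive BareDiagram : ℕ → Type
  | empty : BareDiagram 0
  | wire : BareDiagram 1
  | neg : BareDiagram 1
  | swap : BareDiagram 2
  | pbs : BareDiagram 2
  | gate : BareDiagram 1
  /-- Sequential composition `D₂ ∘ D₁` (first `D₁`, then `D₂`). -/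
  | comp {n : ℕ} (D₂ D₁ : BareDiagram n) : BareDiagram n
  /-- Parallel composition `D₁ ⊕ D₂`. -/
  | par {n m : ℕ} (D₁ : BareDiagram n) (D₂ : BareDiagram m) : BareDiagram (n + m)
  /-- Feedback loop: the last output is connected to the last input. -/
  | trace {n : ℕ} (D : BareDiagram (n + 1)) : BareDiagram n

namespace BareDiagram

/-- The alphabet of a bare diagram: its gate occurrences. -/
def Gate : {n : ℕ} → BareDiagram n → Type
  | _, empty => Empty
  | _, wire => Empty
  | _, neg => Empty
  | _, swap => Empty
  | _, pbs => Empty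
  | _, gate => Unit
  | _, comp D₂ D₁ => D₁.Gate ⊕ D₂.Gate
  | _, par D₁ D₂ => D₁.Gate ⊕ D₂.Gate
  | _, trace D => D.Gate

instance instDecidableEqGate : {n : ℕ} → (D : BareDiagram n) → DecidableEq D.Gate
  | _, empty => inferInstanceAs (DecidableEq Empty)
  | _, wire => inferInstanceAs (DecidableEq Empty)
  | _, neg => inferInstanceAs (DecidableEq Empty)
  | _, swap => inferInstanceAs (DecidableEq Empty)
  | _, pbs => inferInstanceAs (DecidableEq Empty)
  | _, gate => inferInstanceAs (DecidableEq Unit)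
  | _, comp D₂ D₁ =>
    letI := instDecidableEqGate D₁
    letI := instDecidableEqGate D₂
    inferInstanceAs (DecidableEq (D₁.Gate ⊕ D₂.Gate))
  | _, par D₁ D₂ =>
    letI := instDecidableEqGate D₁
    letI := instDecidableEqGate D₂
    inferInstanceAs (DecidableEq (D₁.Gate ⊕ D₂.Gate))
  | _, trace D => instDecidableEqGate D

instance instFintypeGate : {n : ℕ} → (D : BareDiagram n) → Fintype D.Gate
  | _, empty => inferInstanceAs (Fintype Empty)
  | _, wire => inferInstanceAs (Fintype Empty)
  | _, neg => inferInstanceAs (Fintype Empty)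
  | _, swap => inferInstanceAs (Fintype Empty)
  | _, pbs => inferInstanceAs (Fintype Empty)
  | _, gate => inferInstanceAs (Fintype Unit)
  | _, comp D₂ D₁ =>
    letI := instFintypeGate D₁
    letI := instFintypeGate D₂
    inferInstanceAs (Fintype (D₁.Gate ⊕ D₂.Gate))
  | _, par D₁ D₂ =>
    letI := instFintypeGate D₁
    letI := instFintypeGate D₂
    inferInstanceAs (Fintype (D₁.Gate ⊕ D₂.Gate))
  | _, trace D => instFintypeGate D

/-! ### Word path semantics -/

/-- The word path semantics `(D, s) ⇒ʷ s'`, where a configuration `s` is a pair of a polarisation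
and a position, and `w` is the word of the gates crossed, in the order in which they are crossed. -/
inductive Path : {n : ℕ} → (D : BareDiagram n) → Pol × Fin n → List D.Gate → Pol × Fin n → Prop
  | wire (c : Pol) : Path wire (c, 0) [] (c, 0)
  | neg (c : Pol) : Path neg (c, 0) [] (c.flip, 0)
  | swap (c : Pol) (p : Fin 2) : Path swap (c, p) [] (c, p.rev)
  | pbs_hor (p : Fin 2) : Path pbs (Pol.hor, p) [] (Pol.hor, p)
  | pbs_ver (p : Fin 2) : Path pbs (Pol.ver, p) [] (Pol.ver, p.rev)
  | gate (c : Pol) : Path gate (c, 0) [()] (c, 0)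
  | comp {n : ℕ} {D₂ D₁ : BareDiagram n} {s s' s'' : Pol × Fin n} {w₁ : List D₁.Gate}
      {w₂ : List D₂.Gate} (h₁ : Path D₁ s w₁ s') (h₂ : Path D₂ s' w₂ s'') :
      Path (comp D₂ D₁) s (w₁.map Sum.inl ++ w₂.map Sum.inr) s''
  | par_left {n m : ℕ} {D₁ : BareDiagram n} (D₂ : BareDiagram m) {c c' : Pol} {p p' : Fin n}
      {w : List D₁.Gate} (h : Path D₁ (c, p) w (c', p')) :
      Path (par D₁ D₂) (c, p.castAdd m) (w.map Sum.inl) (c', p'.castAdd m)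
  | par_right {n m : ℕ} (D₁ : BareDiagram n) {D₂ : BareDiagram m} {c c' : Pol} {p p' : Fin m}
      {w : List D₂.Gate} (h : Path D₂ (c, p) w (c', p')) :
      Path (par D₁ D₂) (c, p.natAdd n) (w.map Sum.inr) (c', p'.natAdd n)
  | trace_zero {n : ℕ} {D : BareDiagram (n + 1)} {c₀ c₁ : Pol} {p p' : Fin n}
      {w₀ : List D.Gate} (h₀ : Path D (c₀, p.castSucc) w₀ (c₁, p'.castSucc)) :
      Path (trace D) (c₀, p) w₀ (c₁, p')
  | trace_one {n : ℕ} {D : BareDiagram (n + 1)} {c₀ c₁ c₂ : Pol} {p p' : Fin n}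
      {w₀ w₁ : List D.Gate} (h₀ : Path D (c₀, p.castSucc) w₀ (c₁, Fin.last n))
      (h₁ : Path D (c₁, Fin.last n) w₁ (c₂, p'.castSucc)) :
      Path (trace D) (c₀, p) (w₀ ++ w₁) (c₂, p')
  | trace_two {n : ℕ} {D : BareDiagram (n + 1)} {c₀ c₁ c₂ c₃ : Pol} {p p' : Fin n}
      {w₀ w₁ w₂ : List D.Gate} (h₀ : Path D (c₀, p.castSucc) w₀ (c₁, Fin.last n))
      (h₁ : Path D (c₁, Fin.last n) w₁ (c₂, Fin.last n))
      (h₂ : Path D (c₂, Fin.last n) w₂ (c₃, p'.castSucc)) :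
      Path (trace D) (c₀, p) (w₀ ++ (w₁ ++ w₂)) (c₃, p')

/-- Iterates `f`, at most `k` times, until the position is not the last one; the words met on the
way are concatenated. The default value in the case `k = 0` is never used by `run`
(see `path_iff_run`). -/
def feedback {G : Type} {n : ℕ} (f : Pol × Fin (n + 1) → List G × (Pol × Fin (n + 1)))
    (p₀ : Fin n) : ℕ → Pol × Fin (n + 1) → List G × (Pol × Fin n)
  | 0, s => ([], (s.1, p₀))
  | k + 1, s =>
    if h : (f s).2.2 = Fin.last n then
      ((f s).1 ++ (feedback f p₀ k (f s).2).1, (feedback f p₀ k (f s).2).2)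
    else ((f s).1, ((f s).2.1, (f s).2.2.castPred h))

/-- The word path semantics as a function: `D.run s` is the pair of the word `w` and the final
configuration `s'` with `(D, s) ⇒ʷ s'` (see `path_iff_run`). -/
def run : {n : ℕ} → (D : BareDiagram n) → Pol × Fin n → List D.Gate × (Pol × Fin n)
  | _, empty, s => ([], s)
  | _, wire, s => ([], s)
  | _, neg, s => ([], (s.1.flip, s.2))
  | _, swap, s => ([], (s.1, s.2.rev))
  | _, pbs, s =>
    match s.1 with
    | Pol.hor => ([], s)
    | Pol.ver => ([], (s.1, s.2.rev))
  | _, gate, s => ([()], s)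
  | _, comp D₂ D₁, s =>
    ((D₁.run s).1.map Sum.inl ++ (D₂.run (D₁.run s).2).1.map Sum.inr, (D₂.run (D₁.run s).2).2)
  | _, par (n := n) (m := m) D₁ D₂, s =>
    Fin.addCases (motive := fun _ => List (D₁.Gate ⊕ D₂.Gate) × (Pol × Fin (n + m)))
      (fun p => ((D₁.run (s.1, p)).1.map Sum.inl,
        ((D₁.run (s.1, p)).2.1, (D₁.run (s.1, p)).2.2.castAdd m)))
      (fun p => ((D₂.run (s.1, p)).1.map Sum.inr,
        ((D₂.run (s.1, p)).2.1, (D₂.run (s.1, p)).2.2.natAdd n)))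
      s.2
  | _, trace D, s => feedback D.run s.2 3 (s.1, s.2.castSucc)

/-- A particle that enters through an input wire meets the feedback wire at most twice. -/
theorem not_three_loops {G : Type} {n : ℕ}
    (f : Pol × Fin (n + 1) → List G × (Pol × Fin (n + 1)))
    (hf : Function.Injective fun s => (f s).2) (c : Pol) (p : Fin n)
    (h₁ : (f (c, p.castSucc)).2.2 = Fin.last n)
    (h₂ : (f (f (c, p.castSucc)).2).2.2 = Fin.last n) :
    (f (f (f (c, p.castSucc)).2).2).2.2 ≠ Fin.last n := by
  intro h₃
  have h₀ : (c, p.castSucc).2 ≠ Fin.last n := Fin.castSucc_ne_last p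
  generalize (c, p.castSucc) = s at *
  have hf' : ∀ {x y}, (f x).2 = (f y).2 → x = y := fun h => hf h
  have e₁ : (f s).2 ≠ (f (f s).2).2 := fun h => h₀ (by rw [hf' h]; exact h₁)
  have e₂ : (f s).2 ≠ (f (f (f s).2).2).2 := fun h => h₀ (by rw [hf' h]; exact h₂)
  have e₃ : (f (f s).2).2 ≠ (f (f (f s).2).2).2 := fun h => e₁ (hf' h)
  generalize (f (f (f s).2).2).2 = s₃ at *
  generalize (f (f s).2).2 = s₂ at *
  generalize (f s).2 = s₁ at *
  obtain ⟨c₁, p₁⟩ := s₁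
  obtain ⟨c₂, p₂⟩ := s₂
  obtain ⟨c₃, p₃⟩ := s₃
  cases c₁ <;> cases c₂ <;> cases c₃ <;> simp_all

theorem feedback_injective {G : Type} {n : ℕ}
    (f : Pol × Fin (n + 1) → List G × (Pol × Fin (n + 1)))
    (hf : Function.Injective fun s => (f s).2) :
    Function.Injective fun s : Pol × Fin n => (feedback f s.2 3 (s.1, s.2.castSucc)).2 := by
  have hf' : ∀ {x y}, (f x).2 = (f y).2 → x = y := fun h => hf h
  have key : ∀ {x y : Pol × Fin (n + 1)} (hx : (f x).2.2 ≠ Fin.last n)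
      (hy : (f y).2.2 ≠ Fin.last n),
      ((f x).2.1, (f x).2.2.castPred hx) = ((f y).2.1, (f y).2.2.castPred hy) → x = y := by
    intro x y hx hy h
    have h₁ := congrArg Prod.fst h
    have h₂ := congrArg Prod.snd h
    exact hf' (Prod.ext h₁ ((Fin.castPred_inj (hi := hx) (hj := hy)).mp h₂))
  rintro ⟨c, p⟩ ⟨d, q⟩ h
  have hs : (c, p.castSucc).2 ≠ Fin.last n := Fin.castSucc_ne_last p
  have ht : (d, q.castSucc).2 ≠ Fin.last n := Fin.castSucc_ne_last q
  have ls := not_three_loops f hf c p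
  have lt := not_three_loops f hf d q
  suffices (c, p.castSucc) = (d, q.castSucc) by
    simpa using this
  simp only [feedback] at h
  generalize (c, p.castSucc) = s at *
  generalize (d, q.castSucc) = t at *
  split_ifs at h with a₁ a₂ a₃ b₁ b₂ b₃ b₁ b₂ b₃ b₁ b₂ b₃ b₁ b₂ b₃
  all_goals first
    | exact absurd a₃ (ls a₁ a₂)
    | exact absurd b₃ (lt b₁ b₂)
    | exact key _ _ h
    | exact hf' (key _ _ h)
    | exact hf' (hf' (key _ _ h))
    | exact absurd (by rw [key _ _ h]; assumption) hs
    | exact absurd (by rw [← key _ _ h]; assumption) ht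
    | exact absurd (by rw [hf' (key _ _ h)]; assumption) hs
    | exact absurd (by rw [← hf' (key _ _ h)]; assumption) ht

theorem run_injective : {n : ℕ} → (D : BareDiagram n) → Function.Injective fun s => (D.run s).2
  | _, empty => by intro s t h; simpa [run] using h
  | _, wire => by intro s t h; simpa [run] using h
  | _, neg => by
    rintro ⟨c, p⟩ ⟨c', p'⟩ h
    cases c <;> cases c' <;> simp_all [run, Pol.flip]
  | _, swap => by
    rintro ⟨c, p⟩ ⟨c', p'⟩ h
    simpa [run] using h
  | _, pbs => by
    rintro ⟨c, p⟩ ⟨c', p'⟩ h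
    cases c <;> cases c' <;> simp_all [run]
  | _, gate => by intro s t h; simpa [run] using h
  | _, comp D₂ D₁ => by
    intro s t h
    exact run_injective D₁ (run_injective D₂ h)
  | _, par (n := n) (m := m) D₁ D₂ => by
    rintro ⟨c, p⟩ ⟨c', p'⟩ h
    have h₁ := @run_injective _ D₁
    have h₂ := @run_injective _ D₂
    induction p using Fin.addCases with
    | left p =>
      induction p' using Fin.addCases with
      | left p' =>
        have := @h₁ (c, p) (c', p')
        simp [run] at h
        simp_all [Prod.ext_iff]
      | right p' =>
        simp [run, Fin.ext_iff] at h
        omega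
    | right p =>
      induction p' using Fin.addCases with
      | left p' =>
        simp [run, Fin.ext_iff] at h
        omega
      | right p' =>
        have := @h₂ (c, p) (c', p')
        simp [run] at h
        simp_all [Prod.ext_iff]
  | _, trace D => feedback_injective D.run (run_injective D)

theorem path_run : {n : ℕ} → (D : BareDiagram n) → (s : Pol × Fin n) →
    Path D s (D.run s).1 (D.run s).2
  | _, empty, s => s.2.elim0
  | _, wire, (c, p) => by
    obtain rfl := Subsingleton.elim p 0
    exact .wire c
  | _, neg, (c, p) => by
    obtain rfl := Subsingleton.elim p 0
    exact .neg c
  | _, swap, (c, p) => .swap c p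
  | _, pbs, (Pol.hor, p) => .pbs_hor p
  | _, pbs, (Pol.ver, p) => .pbs_ver p
  | _, gate, (c, p) => by
    obtain rfl := Subsingleton.elim p 0
    exact .gate c
  | _, comp D₂ D₁, s => .comp (path_run D₁ s) (path_run D₂ _)
  | _, par (n := n) (m := m) D₁ D₂, (c, p) => by
    have h₁ := path_run D₁
    have h₂ := path_run D₂
    induction p using Fin.addCases with
    | left p =>
      simp only [run, Fin.addCases_left]
      exact Path.par_left D₂ (h₁ (c, p))
    | right p =>
      simp only [run, Fin.addCases_right]
      exact Path.par_right D₁ (h₂ (c, p))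
  | _, trace (n := n) D, (c, p) => by
    have hD := path_run D
    have hloop := not_three_loops D.run (run_injective D) c p
    simp only [run, feedback]
    have h₀ := hD (c, p.castSucc)
    have h₁ := hD (D.run (c, p.castSucc)).2
    have h₂ := hD (D.run (D.run (c, p.castSucc)).2).2
    generalize hr₂ : D.run (D.run (D.run (c, p.castSucc)).2).2 = r₂ at *
    generalize hr₁ : D.run (D.run (c, p.castSucc)).2 = r₁ at *
    generalize hr₀ : D.run (c, p.castSucc) = r₀ at *
    obtain ⟨w₀, c₁, p₁⟩ := r₀
    obtain ⟨w₁, c₂, p₂⟩ := r₁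
    obtain ⟨w₂, c₃, p₃⟩ := r₂
    dsimp only at *
    split_ifs with a₁ a₂ a₃
    · exact absurd a₃ (hloop a₁ a₂)
    · subst a₁ a₂
      rw [← Fin.castSucc_castPred p₃ a₃] at h₂
      exact .trace_two h₀ h₁ h₂
    · subst a₁
      rw [← Fin.castSucc_castPred p₂ a₂] at h₁
      exact .trace_one h₀ h₁
    · rw [← Fin.castSucc_castPred p₁ a₁] at h₀
      exact .trace_zero h₀

theorem run_eq_of_path {n : ℕ} {D : BareDiagram n} {s s' : Pol × Fin n} {w : List D.Gate}
    (h : Path D s w s') : D.run s = (w, s') := by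
  induction h with
  | par_left D₂ h ih => simp [run, ih]; rfl
  | par_right D₁ h ih => simp [run, ih]; rfl
  | trace_one => simp_all [run, feedback, Fin.castSucc_ne_last]; rfl
  | trace_two => simp_all [run, feedback, Fin.castSucc_ne_last]; rfl
  | _ => simp_all [run, feedback, Fin.castSucc_ne_last]

/-- The word path semantics is well defined and deterministic. -/
theorem path_iff_run {n : ℕ} (D : BareDiagram n) (s s' : Pol × Fin n) (w : List D.Gate) :
    Path D s w s' ↔ D.run s = (w, s') := by
  refine ⟨run_eq_of_path, fun h => ?_⟩
  have := path_run D s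
  rwa [h] at this

end BareDiagram

/-! ### Purified channels

Hilbert spaces are finite-dimensional and given with an orthonormal basis: the data space `H` is
`ℂ^ι` for a finite type `ι`, the tensor product of `ℂ^ι` and `ℂ^κ` is `ℂ^(ι × κ)`, and linear
operators are matrices. -/

/-- A purified `H`-channel `[U, |ε⟩, E]`, where `H = ℂ^ι` and `E = ℂ^env`. -/
structure PurifiedChannel (ι : Type u) [Fintype ι] [DecidableEq ι] where
  /-- The index type of the orthonormal basis of the environment space `E`. -/
  env : Type v
  [fintypeEnv : Fintype env]
  [decidableEqEnv : DecidableEq env]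
  /-- The initial state of the environment, a unit vector. -/
  ε : EuclideanSpace ℂ env
  norm_ε : ‖ε‖ = 1
  /-- The unitary evolution of the joint system `H ⊗ E`. -/
  U : Matrix.unitaryGroup (ι × env) ℂ

attribute [instance] PurifiedChannel.fintypeEnv PurifiedChannel.decidableEqEnv

section Operators

variable {κ : Type*} {η : Type*}

/-- Partial trace over the second tensor factor. -/
def partialTrace [Fintype η] (M : Matrix (κ × η) (κ × η) ℂ) : Matrix κ κ ℂ :=
  Matrix.of fun i j => ∑ e, M (i, e) (j, e)

/-- The projector `|ε⟩⟨ε|`. -/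
def ketBra (ε : η → ℂ) : Matrix η η ℂ :=
  Matrix.vecMulVec ε (star ε)

/-- The operator `I ⊗ |ε⟩` from `ℂ^κ` to `ℂ^κ ⊗ ℂ^η`. Its adjoint is `I ⊗ ⟨ε|`. -/
def idTensorKet [DecidableEq κ] (ε : η → ℂ) : Matrix (κ × η) κ ℂ :=
  Matrix.of fun x j => if x.1 = j then ε x.2 else 0

/-- The superoperator `ρ ↦ Tr_E (U (ρ ⊗ |ε⟩⟨ε|) U†)`. -/
def superoperator [Fintype κ] [Fintype η] (U : Matrix (κ × η) (κ × η) ℂ) (ε : η → ℂ)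
    (ρ : Matrix κ κ ℂ) : Matrix κ κ ℂ :=
  partialTrace (U * (ρ ⊗ₖ ketBra ε) * U.conjTranspose)

/-- The transformation matrix `(I ⊗ ⟨ε|) U (I ⊗ |ε⟩)`. -/
def transformationMatrix [Fintype κ] [DecidableEq κ] [Fintype η]
    (U : Matrix (κ × η) (κ × η) ℂ) (ε : η → ℂ) : Matrix κ κ ℂ :=
  (idTensorKet (κ := κ) ε).conjTranspose * U * idTensorKet (κ := κ) ε

/-- The swap operator `|ψ₁⟩ ⊗ |ψ₂⟩ ↦ |ψ₂⟩ ⊗ |ψ₁⟩`. -/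
def swapOperator [DecidableEq κ] : Matrix (κ × κ) (κ × κ) ℂ :=
  Matrix.of fun x y => if x = y.swap then 1 else 0

end Operators

namespace PurifiedChannel

variable {ι : Type u} [Fintype ι] [DecidableEq ι]

/-- The operator `I ⊗ U` on `H ⊗ H ⊗ E`. -/
def idTensorU (P : PurifiedChannel.{u, v} ι) :
    Matrix ((ι × ι) × P.env) ((ι × ι) × P.env) ℂ :=
  ((1 : Matrix ι ι ℂ) ⊗ₖ (P.U : Matrix (ι × P.env) (ι × P.env) ℂ)).submatrix
    (Equiv.prodAssoc ι ι P.env) (Equiv.prodAssoc ι ι P.env)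

/-- `U⁽²⁾ = (I ⊗ U) (𝔖 ⊗ I) (I ⊗ U)` on `H ⊗ H ⊗ E`. -/
def U₂ (P : PurifiedChannel.{u, v} ι) : Matrix ((ι × ι) × P.env) ((ι × ι) × P.env) ℂ :=
  P.idTensorU * (swapOperator ⊗ₖ (1 : Matrix P.env P.env ℂ)) * P.idTensorU

/-- The first-level transformation matrix. -/
def T₁ (P : PurifiedChannel.{u, v} ι) : Matrix ι ι ℂ :=
  transformationMatrix (P.U : Matrix (ι × P.env) (ι × P.env) ℂ) P.ε

/-- The second-level superoperator. -/
def S₂ (P : PurifiedChannel.{u, v} ι) : Matrix (ι × ι) (ι × ι) ℂ → Matrix (ι × ι) (ι × ι) ℂ :=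
  superoperator P.U₂ P.ε

/-- The second-level transformation matrix. -/
def T₂ (P : PurifiedChannel.{u, v} ι) : Matrix (ι × ι) (ι × ι) ℂ :=
  transformationMatrix P.U₂ P.ε

end PurifiedChannel

/-! ### Families of purified channels and the global environment -/

section Families

variable {ι : Type u} [Fintype ι] [DecidableEq ι] {Γ : Type} [Fintype Γ] [DecidableEq Γ]

/-- The index type of the orthonormal basis of the global environment `⨂_a E_a`. -/
abbrev GlobalEnv (G : Γ → PurifiedChannel.{u, v} ι) : Type v :=
  (a : Γ) → (G a).env

/-- The initial state `⨂_a |ε_a⟩` of the global environment. -/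
def globalState (G : Γ → PurifiedChannel.{u, v} ι) : GlobalEnv G → ℂ :=
  fun e => ∏ a, (G a).ε (e a)

/-- The operator on `H ⊗ ⨂_x E_x` that acts as `U_a` on `H ⊗ E_a` and as the identity on `E_x` for
all `x ≠ a`. -/
def gateOperator (G : Γ → PurifiedChannel.{u, v} ι) (a : Γ) :
    Matrix (ι × GlobalEnv G) (ι × GlobalEnv G) ℂ :=
  Matrix.of fun x y =>
    if ∀ b, b ≠ a → x.2 b = y.2 b then
      (G a).U.1 (x.1, x.2 a) (y.1, y.2 a)
    else 0

/-- The operator of a word: the gates are applied in the order of the word, from left to right. -/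
def wordOperator (G : Γ → PurifiedChannel.{u, v} ι) :
    List Γ → Matrix (ι × GlobalEnv G) (ι × GlobalEnv G) ℂ
  | [] => 1
  | a :: w => wordOperator G w * gateOperator G a

end Families

namespace BareDiagram

variable {ι : Type u} [Fintype ι] [DecidableEq ι] {n : ℕ}

/-- The operator `∑_{c,p} |c'⟩⟨c| ⊗ |p'⟩⟨p| ⊗ V_w` on `(ℂ^{→,↑} ⊗ ℂ^[n] ⊗ H) ⊗ ⨂_a E_a`, where
`(D, c, p) ⇒ʷ (c', p')`. -/
def diagramOperator (D : BareDiagram n) (G : D.Gate → PurifiedChannel.{u, v} ι) :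
    Matrix ((Pol × Fin n × ι) × GlobalEnv G) ((Pol × Fin n × ι) × GlobalEnv G) ℂ :=
  Matrix.of fun x y =>
    if (x.1.1, x.1.2.1) = (D.run (y.1.1, y.1.2.1)).2 then
      wordOperator G (D.run (y.1.1, y.1.2.1)).1 (x.1.2.2, x.2) (y.1.2.2, y.2)
    else 0

/-- The superoperator induced by `D` on the polarisation, the position and the data register, when
its gates are filled with the family `G`. -/
def semantics (D : BareDiagram n) (G : D.Gate → PurifiedChannel.{u, v} ι) :
    Matrix (Pol × Fin n × ι) (Pol × Fin n × ι) ℂ →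
      Matrix (Pol × Fin n × ι) (Pol × Fin n × ι) ℂ :=
  superoperator (D.diagramOperator G) (globalState G)

end BareDiagram

/-! ### Extended PBS-diagrams -/

/-- Extended PBS-diagrams: the gates are filled with purified channels. -/
inductive ExtDiagram (ι : Type u) [Fintype ι] [DecidableEq ι] : ℕ → Type (max u (v + 1))
  | empty : ExtDiagram ι 0
  | wire : ExtDiagram ι 1
  | neg : ExtDiagram ι 1
  | swap : ExtDiagram ι 2
  | pbs : ExtDiagram ι 2
  | gate (P : PurifiedChannel.{u, v} ι) : ExtDiagram ι 1
  | comp {n : ℕ} (D₂ D₁ : ExtDiagram ι n) : ExtDiagram ι n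
  | par {n m : ℕ} (D₁ : ExtDiagram ι n) (D₂ : ExtDiagram ι m) : ExtDiagram ι (n + m)
  | trace {n : ℕ} (D : ExtDiagram ι (n + 1)) : ExtDiagram ι n

namespace ExtDiagram

variable {ι : Type u} [Fintype ι] [DecidableEq ι]

/-- The extended diagram `[D']_G`, obtained from a bare diagram `D'` by filling its gates with the
family `G`. -/
def ofBare : {n : ℕ} → (D' : BareDiagram n) → (D'.Gate → PurifiedChannel.{u, v} ι) →
    ExtDiagram.{u, v} ι n
  | _, .empty, _ => empty
  | _, .wire, _ => wire
  | _, .neg, _ => neg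
  | _, .swap, _ => swap
  | _, .pbs, _ => pbs
  | _, .gate, G => gate (G ())
  | _, .comp D₂ D₁, G => comp (ofBare D₂ fun a => G (Sum.inr a)) (ofBare D₁ fun a => G (Sum.inl a))
  | _, .par D₁ D₂, G => par (ofBare D₁ fun a => G (Sum.inl a)) (ofBare D₂ fun a => G (Sum.inr a))
  | _, .trace D, G => trace (ofBare D G)

/-- The underlying bare diagram. -/
def bare : {n : ℕ} → ExtDiagram.{u, v} ι n → BareDiagram n
  | _, empty => .empty
  | _, wire => .wire
  | _, neg => .neg
  | _, swap => .swap
  | _, pbs => .pbs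
  | _, gate _ => .gate
  | _, comp D₂ D₁ => .comp D₂.bare D₁.bare
  | _, par D₁ D₂ => .par D₁.bare D₂.bare
  | _, trace D => .trace D.bare

/-- The family of purified channels with which the gates of the underlying bare diagram are
filled. -/
def family : {n : ℕ} → (D : ExtDiagram.{u, v} ι n) → D.bare.Gate → PurifiedChannel.{u, v} ι
  | _, empty => Empty.elim
  | _, wire => Empty.elim
  | _, neg => Empty.elim
  | _, swap => Empty.elim
  | _, pbs => Empty.elim
  | _, gate P => fun _ => P
  | _, comp D₂ D₁ => Sum.elim D₁.family D₂.family
  | _, par D₁ D₂ => Sum.elim D₁.family D₂.family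
  | _, trace D => D.family

theorem ofBare_bare_family : {n : ℕ} → (D : ExtDiagram.{u, v} ι n) → ofBare D.bare D.family = D
  | _, empty => rfl
  | _, wire => rfl
  | _, neg => rfl
  | _, swap => rfl
  | _, pbs => rfl
  | _, gate _ => rfl
  | _, comp D₂ D₁ => congrArg₂ comp (ofBare_bare_family D₂) (ofBare_bare_family D₁)
  | _, par D₁ D₂ => congrArg₂ par (ofBare_bare_family D₁) (ofBare_bare_family D₂)
  | _, trace D => congrArg trace (ofBare_bare_family D)

/-- The quantum semantics `⟦D⟧` of an extended PBS-diagram. -/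
def semantics {n : ℕ} (D : ExtDiagram.{u, v} ι n) :
    Matrix (Pol × Fin n × ι) (Pol × Fin n × ι) ℂ →
      Matrix (Pol × Fin n × ι) (Pol × Fin n × ι) ℂ :=
  D.bare.semantics D.family

end ExtDiagram

/-! ### Contexts and observational equivalence -/

/-- Contexts: extended PBS-diagrams with exactly one hole. -/
inductive Context (ι : Type u) [Fintype ι] [DecidableEq ι] : ℕ → Type (max u (v + 1))
  | hole : Context ι 1
  /-- `D ∘ C[·]` -/
  | compLeft {n : ℕ} (D : ExtDiagram.{u, v} ι n) (C : Context ι n) : Context ι n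
  /-- `C[·] ∘ D` -/
  | compRight {n : ℕ} (C : Context ι n) (D : ExtDiagram.{u, v} ι n) : Context ι n
  /-- `D ⊕ C[·]` -/
  | parLeft {m n : ℕ} (D : ExtDiagram.{u, v} ι m) (C : Context ι n) : Context ι (m + n)
  /-- `C[·] ⊕ D` -/
  | parRight {n m : ℕ} (C : Context ι n) (D : ExtDiagram.{u, v} ι m) : Context ι (n + m)
  | trace {n : ℕ} (C : Context ι (n + 1)) : Context ι n

/-- The substitution `C[U, |ε⟩, E]`: the hole is replaced by a gate filled with the purified
channel `P`. -/
def Context.subst {ι : Type u} [Fintype ι] [DecidableEq ι] :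
    {n : ℕ} → Context.{u, v} ι n → PurifiedChannel.{u, v} ι → ExtDiagram.{u, v} ι n
  | _, .hole, P => .gate P
  | _, .compLeft D C, P => .comp D (C.subst P)
  | _, .compRight C D, P => .comp (C.subst P) D
  | _, .parLeft D C, P => .par D (C.subst P)
  | _, .parRight C D, P => .par (C.subst P) D
  | _, .trace C, P => .trace (C.subst P)

/-- Observational equivalence `P ≈₂ Q`: no context with a single input/output wire
distinguishes `P` and `Q`. -/
def ObsEquiv₂ {ι : Type u} [Fintype ι] [DecidableEq ι] (P Q : PurifiedChannel.{u, v} ι) : Prop :=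
  ∀ C : Context.{u, v} ι 1, (C.subst P).semantics = (C.subst Q).semantics

/-! A fixed sequence of data transitions `y → x` through a channel applies the blocks `⟨x|U|y⟩` to
`|ε⟩` and leaves the environment in a vector, its `history`. Everything that a diagram reveals about
the channel in the hole is contained in inner products of two such vectors. Indeed a word acts on a
product state as a sum over data paths of product states whose factor at each gate is a history, and
tracing out the environments turns a matrix element of the semantics into sums of products of
`historyGram`s, one per gate (`semantics_eq_iff`, `envGram_wordOperator_congr`).

Sufficiency is then a count. The path semantics is injective, and summed over all inputs a gate is
crossed at most twice (`sum_count_run_le`). Two paths therefore use the hole `(k, l)` times with `k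
+ l ≤ 2` or `k = l = 2`. The pair (0,0) is the norm of `|ε⟩`, (1,0) is `T₁`, (2,0) is `T₂`, (2,2) is
`S₂`, the mirror images are conjugates, and (1,1) follows from (2,2) by unitarity
(`historyGram_eq_of_usePair`). This holds for any number of wires.

For necessity, interference between a polarisation that crosses the hole once and one that bypasses
it gives `T₁`. For the second level, the hole is placed between two memories `B` and `C` and crossed
twice: `B` supplies the input of the second use, `C` stores the output of the first. Suitable
memories make one matrix element of the semantics equal to one prescribed Gram entry
(`ObsEquiv₂.historyGram_eq`). -/

/-! ### Matrix elements of superoperators and transformation matrices. -/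

section Superoperator

variable {κ : Type*} {η : Type*} [Fintype κ] [Fintype η]

/-- The matrix elements `⟨i| Tr_E (U |k⟩⟨l| ⊗ |ε⟩⟨ε| U†) |j⟩` of a superoperator. -/
def superoperatorKernel (U : Matrix (κ × η) (κ × η) ℂ) (ε : η → ℂ) (i j k l : κ) : ℂ :=
  ∑ e, (∑ f, U (i, e) (k, f) * ε f) * star (∑ f, U (j, e) (l, f) * ε f)

theorem superoperator_apply (U : Matrix (κ × η) (κ × η) ℂ) (ε : η → ℂ) (ρ : Matrix κ κ ℂ)
    (i j : κ) :
    superoperator U ε ρ i j = ∑ k, ∑ l, ρ k l * superoperatorKernel U ε i j k l := by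
  have key : ∀ e, (U * (ρ ⊗ₖ ketBra ε) * U.conjTranspose) (i, e) (j, e) =
      ∑ k, ∑ l, ρ k l * ((∑ f, U (i, e) (k, f) * ε f) * star (∑ f, U (j, e) (l, f) * ε f)) := by
    intro e
    simp only [Matrix.mul_apply, Fintype.sum_prod_type, Matrix.conjTranspose_apply, ketBra,
      Matrix.kroneckerMap_apply, Matrix.vecMulVec_apply, Pi.star_apply, star_sum, star_mul']
    refine Eq.trans ?_ Finset.sum_comm
    refine Finset.sum_congr rfl fun l _ => ?_
    simp only [Finset.sum_mul _ _ (star (U _ _))]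
    refine Finset.sum_comm.trans ?_
    refine Finset.sum_congr rfl fun k _ => ?_
    simp only [Finset.sum_mul]
    rw [Finset.sum_comm, Finset.mul_sum]
    refine Finset.sum_congr rfl fun f _ => ?_
    rw [Finset.mul_sum, Finset.mul_sum]
    exact Finset.sum_congr rfl fun _ _ => by ring
  simp only [superoperator, partialTrace, Matrix.of_apply, key, superoperatorKernel,
    Finset.mul_sum]
  rw [Finset.sum_comm]
  exact Finset.sum_congr rfl fun k _ => Finset.sum_comm

/-- Linearity in `ρ` reduces equality to matrix units. The environments may differ, as they do when
a hole is filled in two ways. -/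
theorem superoperator_eq_iff {η' : Type*} [Fintype η'] [DecidableEq κ]
    (U : Matrix (κ × η) (κ × η) ℂ) (ε : η → ℂ) (U' : Matrix (κ × η') (κ × η') ℂ) (ε' : η' → ℂ) :
    superoperator U ε = superoperator U' ε' ↔
      ∀ i j k l, superoperatorKernel U ε i j k l = superoperatorKernel U' ε' i j k l := by
  constructor
  · intro h i j k l
    have := congrFun (congrFun (congrFun h (Matrix.single k l 1)) i) j
    simpa [superoperator_apply, Matrix.single_apply, ite_and] using this
  · intro h
    ext ρ i j
    simp only [superoperator_apply, h]

theorem transformationMatrix_apply [DecidableEq κ] (U : Matrix (κ × η) (κ × η) ℂ) (ε : η → ℂ)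
    (i j : κ) :
    transformationMatrix U ε i j = ∑ e, (∑ f, U (i, e) (j, f) * ε f) * star (ε e) := by
  simp only [transformationMatrix, Matrix.mul_apply, Fintype.sum_prod_type,
    Matrix.conjTranspose_apply, idTensorKet, Matrix.of_apply]
  simp only [apply_ite star, star_zero, ite_mul, zero_mul, mul_ite, mul_zero,
    Finset.sum_ite_irrel, Finset.sum_const_zero]
  simp only [Finset.sum_ite_eq', Finset.mem_univ, if_true, Finset.sum_mul]
  rw [Finset.sum_comm]
  exact Finset.sum_congr rfl fun _ _ => Finset.sum_congr rfl fun _ _ => by ring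

end Superoperator

/-! ### Gram entries of environment histories. -/

namespace PurifiedChannel

variable {ι : Type u} [Fintype ι] [DecidableEq ι]

/-- The block `⟨x| U |y⟩` of the evolution, an operator on the environment. -/
def block (P : PurifiedChannel.{u, v} ι) (x y : ι) : Matrix P.env P.env ℂ :=
  Matrix.of fun e f => P.U.1 (x, e) (y, f)

/-- The (unnormalised) state of the environment after a history of transitions of the data
register; the head of the list is the last transition, and a transition from `y` to `x` is written
`(x, y)`. -/
def history (P : PurifiedChannel.{u, v} ι) : List (ι × ι) → P.env → ℂ
  | [] => fun e => P.ε e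
  | p :: s => (P.block p.1 p.2).mulVec (P.history s)

/-- The inner products of the states of the environment. -/
def historyGram (P : PurifiedChannel.{u, v} ι) (s t : List (ι × ι)) : ℂ :=
  ∑ e, P.history s e * star (P.history t e)

theorem star_historyGram (P : PurifiedChannel.{u, v} ι) (s t : List (ι × ι)) :
    star (P.historyGram s t) = P.historyGram t s := by
  simp [historyGram, mul_comm]

theorem historyGram_nil (P : PurifiedChannel.{u, v} ι) : P.historyGram [] [] = 1 := by
  have h := P.norm_ε
  have h2 := EuclideanSpace.norm_sq_eq P.ε
  simp only [historyGram, history]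
  rw [h] at h2
  simp only [Complex.star_def, Complex.mul_conj, Complex.normSq_eq_norm_sq]
  exact_mod_cast h2.symm.trans (one_pow 2)

/-- This is the diagonal block at `y` of `U†U = 1`. -/
theorem sum_block_conjTranspose_mul (P : PurifiedChannel.{u, v} ι) (y : ι) :
    ∑ x, (P.block x y).conjTranspose * P.block x y = 1 := by
  ext e f
  have h := congrFun (congrFun (Matrix.mem_unitaryGroup_iff'.mp P.U.2) (y, e)) (y, f)
  simp only [Matrix.mul_apply, Fintype.sum_prod_type, Matrix.one_apply, Prod.mk.injEq, true_and,
    Matrix.star_apply] at h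
  simpa [Matrix.sum_apply, Matrix.mul_apply, block, Matrix.one_apply] using h

/-- Forgetting the last transition. -/
theorem sum_historyGram_cons (P : PurifiedChannel.{u, v} ι) (y : ι) (s t : List (ι × ι)) :
    ∑ x, P.historyGram ((x, y) :: s) ((x, y) :: t) = P.historyGram s t := by
  have h : ∀ s t, P.historyGram s t = P.history s ⬝ᵥ star (P.history t) := fun _ _ => rfl
  simp only [h, history, Matrix.star_mulVec]
  have : ∀ x, (P.block x y).mulVec (P.history s) ⬝ᵥ
      Matrix.vecMul (star (P.history t)) (P.block x y).conjTranspose =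
      ((P.block x y).conjTranspose * P.block x y).mulVec (P.history s) ⬝ᵥ star (P.history t) := by
    intro x
    rw [dotProduct_comm, ← Matrix.dotProduct_mulVec, Matrix.mulVec_mulVec, dotProduct_comm]
  rw [Finset.sum_congr rfl fun x _ => this x, ← sum_dotProduct, ← Matrix.sum_mulVec,
    sum_block_conjTranspose_mul, Matrix.one_mulVec]

/-- The second tensor factor uses the channel first, and the swap then makes it the first factor. So
the first use is `j.2 → i.1` and the second is `j.1 → i.2`, which explains the crossed indices
below. -/
theorem U₂_apply (P : PurifiedChannel.{u, v} ι) (i j : ι × ι) (e f : P.env) :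
    P.U₂ (i, e) (j, f) = ∑ g, P.U.1 (i.2, e) (j.1, g) * P.U.1 (i.1, g) (j.2, f) := by
  simp [U₂, idTensorU, swapOperator, Matrix.mul_apply, Fintype.sum_prod_type,
    Matrix.one_apply, Prod.ext_iff, ite_and]

theorem sum_U₂_mul_ε (P : PurifiedChannel.{u, v} ι) (i j : ι × ι) (e : P.env) :
    ∑ f, P.U₂ (i, e) (j, f) * P.ε f = P.history [(i.2, j.1), (i.1, j.2)] e := by
  simp only [U₂_apply, history, Matrix.mulVec, dotProduct, block, Matrix.of_apply, Finset.mul_sum,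
    Finset.sum_mul, mul_assoc]
  exact Finset.sum_comm

theorem T₁_apply (P : PurifiedChannel.{u, v} ι) (i j : ι) :
    P.T₁ i j = P.historyGram [(i, j)] [] := by
  rw [T₁, transformationMatrix_apply]
  rfl

theorem T₂_apply (P : PurifiedChannel.{u, v} ι) (i j : ι × ι) :
    P.T₂ i j = P.historyGram [(i.2, j.1), (i.1, j.2)] [] := by
  rw [T₂, transformationMatrix_apply]
  simp only [sum_U₂_mul_ε]
  rfl

theorem superoperatorKernel_U₂ (P : PurifiedChannel.{u, v} ι) (i j k l : ι × ι) :
    superoperatorKernel P.U₂ P.ε i j k l =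
      P.historyGram [(i.2, k.1), (i.1, k.2)] [(j.2, l.1), (j.1, l.2)] := by
  simp only [superoperatorKernel, sum_U₂_mul_ε]
  rfl

theorem S₂_eq_iff (P Q : PurifiedChannel.{u, v} ι) :
    P.S₂ = Q.S₂ ↔ ∀ p q p' q', P.historyGram [p, q] [p', q'] = Q.historyGram [p, q] [p', q'] := by
  rw [S₂, S₂, superoperator_eq_iff]
  simp only [superoperatorKernel_U₂]
  exact ⟨fun h p q p' q' => h (q.1, p.1) (q'.1, p'.1) (p.2, q.2) (p'.2, q'.2),
    fun h i j k l => h _ _ _ _⟩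

theorem T₁_eq_iff (P Q : PurifiedChannel.{u, v} ι) :
    P.T₁ = Q.T₁ ↔ ∀ p, P.historyGram [p] [] = Q.historyGram [p] [] := by
  simp only [← Matrix.ext_iff, T₁_apply, Prod.forall]

theorem T₂_eq_iff (P Q : PurifiedChannel.{u, v} ι) :
    P.T₂ = Q.T₂ ↔ ∀ p q, P.historyGram [p, q] [] = Q.historyGram [p, q] [] := by
  simp only [← Matrix.ext_iff, T₂_apply]
  exact ⟨fun h p q => h (q.1, p.1) (p.2, q.2), fun h i j => h _ _⟩

/-- The pairs of numbers of uses of a gate that occur in two paths through a diagram. -/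
def UsePair (k l : ℕ) : Prop := k + l ≤ 2 ∨ k = 2 ∧ l = 2

theorem historyGram_eq_of_usePair {P Q : PurifiedChannel.{u, v} ι} (h₁ : P.T₁ = Q.T₁)
    (h₂ : P.S₂ = Q.S₂) (h₃ : P.T₂ = Q.T₂) (s t : List (ι × ι))
    (hst : UsePair s.length t.length) : P.historyGram s t = Q.historyGram s t := by
  rw [T₁_eq_iff] at h₁
  rw [S₂_eq_iff] at h₂
  rw [T₂_eq_iff] at h₃
  match s, t, hst with
  | [], [], _ => rw [historyGram_nil, historyGram_nil]
  | [p], [], _ => exact h₁ p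
  | [p, q], [], _ => exact h₃ p q
  | [], [p], _ => rw [← star_historyGram, h₁, star_historyGram]
  | [], [p, q], _ => rw [← star_historyGram, h₃, star_historyGram]
  | [p], [q], _ =>
    -- One use each is extended to two uses each by a common further transition, summed over its
    -- output. Its input may be any basis index; `p.1` is one at hand.
    rw [← sum_historyGram_cons P p.1, ← sum_historyGram_cons Q p.1]
    exact Finset.sum_congr rfl fun x _ => h₂ _ _ _ _
  | [p, q], [p', q'], _ => exact h₂ p q p' q'
  | [], _ :: _ :: _ :: _, h => simp [UsePair] at h
  | [_], _ :: _ :: _, h => simp [UsePair] at h; omega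
  | [_, _], [_], h => simp [UsePair] at h
  | [_, _], _ :: _ :: _ :: _, h => simp [UsePair] at h
  | _ :: _ :: _ :: _, _, h => simp [UsePair] at h; omega

end PurifiedChannel

/-! ### Words acting on product states. -/

section ProductStates

variable {ι : Type u} [Fintype ι] [DecidableEq ι] {Γ : Type}

/-- Families of histories are closed under the action of a gate, which is what lets the induction
over words run. -/
theorem update_history [DecidableEq Γ] (G : Γ → PurifiedChannel.{u, v} ι)
    (S : Γ → List (ι × ι)) (a : Γ) (p : ι × ι) :
    Function.update (fun b => (G b).history (S b)) a
        (((G a).block p.1 p.2).mulVec ((G a).history (S a))) =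
      fun b => (G b).history (Function.update S a (p :: S a) b) := by
  ext b
  by_cases hb : b = a
  · subst hb; simp [PurifiedChannel.history]
  · simp [hb]

variable [Fintype Γ]

/-- The product state `|z⟩ ⊗ ⨂_a |ψ_a⟩`. -/
def prodState (G : Γ → PurifiedChannel.{u, v} ι) (z : ι) (ψ : (a : Γ) → (G a).env → ℂ) :
    ι × GlobalEnv G → ℂ :=
  fun x => if x.1 = z then ∏ a, ψ a (x.2 a) else 0

theorem prodState_history_nil (G : Γ → PurifiedChannel.{u, v} ι) (z : ι) (x : ι × GlobalEnv G) :
    prodState G z (fun a => (G a).history []) x = if x.1 = z then globalState G x.2 else 0 :=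
  rfl

variable [DecidableEq Γ]

/-- The partial inner product over the global environment. -/
def envGram (G : Γ → PurifiedChannel.{u, v} ι) (Φ Ψ : ι × GlobalEnv G → ℂ) (x y : ι) : ℂ :=
  ∑ e, Φ (x, e) * star (Ψ (y, e))

variable (G : Γ → PurifiedChannel.{u, v} ι)

theorem envGram_prodState (z z' : ι) (ψ ψ' : (a : Γ) → (G a).env → ℂ) (x y : ι) :
    envGram G (prodState G z ψ) (prodState G z' ψ') x y =
      if x = z ∧ y = z' then ∏ a, ∑ e, ψ a e * star (ψ' a e) else 0 := by
  by_cases hx : x = z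
  · by_cases hy : y = z'
    · simp only [envGram, prodState, hx, hy, if_true, and_self, star_prod,
        ← Finset.prod_mul_distrib]
      rw [Finset.prod_univ_sum, Fintype.piFinset_univ]
    · simp [envGram, prodState, hy]
  · simp [envGram, prodState, hx]

theorem envGram_sum_left {α : Type*} (s : Finset α) (Φ : α → ι × GlobalEnv G → ℂ)
    (Ψ : ι × GlobalEnv G → ℂ) (x y : ι) :
    envGram G (∑ i ∈ s, Φ i) Ψ x y = ∑ i ∈ s, envGram G (Φ i) Ψ x y := by
  simp only [envGram, Finset.sum_apply, Finset.sum_mul]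
  exact Finset.sum_comm

theorem star_envGram (Φ Ψ : ι × GlobalEnv G → ℂ) (x y : ι) :
    star (envGram G Φ Ψ x y) = envGram G Ψ Φ y x := by
  simp [envGram, mul_comm]

theorem envGram_sum_right {α : Type*} (s : Finset α) (Φ : ι × GlobalEnv G → ℂ)
    (Ψ : α → ι × GlobalEnv G → ℂ) (x y : ι) :
    envGram G Φ (∑ i ∈ s, Ψ i) x y = ∑ i ∈ s, envGram G Φ (Ψ i) x y := by
  rw [← star_envGram, envGram_sum_left, star_sum]
  exact Finset.sum_congr rfl fun _ _ => star_envGram ..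

theorem gateOperator_mulVec_prodState (a : Γ) (z : ι) (ψ : (a : Γ) → (G a).env → ℂ) :
    (gateOperator G a).mulVec (prodState G z ψ) =
      ∑ l, prodState G l (Function.update ψ a (((G a).block l z).mulVec (ψ a))) := by
  ext ⟨x, e⟩
  -- The environment states coupled to `e` differ from it at most in the coordinate `a`.
  have hsum : ∀ F : GlobalEnv G → ℂ, (∑ f, if ∀ b, b ≠ a → e b = f b then F f else 0) =
      ∑ t, F (Function.update e a t) := by
    intro F
    rw [← Finset.sum_filter]
    refine Finset.sum_nbij' (fun f => f a) (fun t => Function.update e a t) ?_ ?_ ?_ ?_ ?_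
    · simp
    · intro t _
      simp only [Finset.mem_filter, Finset.mem_univ, true_and]
      intro b hb
      simp [hb]
    · intro f hf
      simp only [Finset.mem_filter, Finset.mem_univ, true_and] at hf
      ext b
      by_cases hb : b = a
      · subst hb; simp
      · simp [hb, hf b hb]
    · simp
    · intro f hf
      simp only [Finset.mem_filter, Finset.mem_univ, true_and] at hf
      congr 1
      ext b
      by_cases hb : b = a
      · subst hb; simp
      · simp [hb, hf b hb]
  have hprod : ∀ (φ : (a : Γ) → (G a).env → ℂ) (f : GlobalEnv G),
      ∏ b, φ b (f b) = φ a (f a) * ∏ b ∈ Finset.univ.erase a, φ b (f b) :=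
    fun φ f => (Finset.mul_prod_erase _ _ (Finset.mem_univ a)).symm
  have herase : ∀ t, ∏ b ∈ Finset.univ.erase a, ψ b (Function.update e a t b) =
      ∏ b ∈ Finset.univ.erase a, ψ b (e b) := by
    intro t
    refine Finset.prod_congr rfl fun b hb => ?_
    rw [Function.update_of_ne (Finset.ne_of_mem_erase hb)]
  have herase' : ∀ t, ∏ b ∈ Finset.univ.erase a, Function.update ψ a t b (e b) =
      ∏ b ∈ Finset.univ.erase a, ψ b (e b) := by
    intro t
    refine Finset.prod_congr rfl fun b hb => ?_
    rw [Function.update_of_ne (Finset.ne_of_mem_erase hb)]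
  have lhs : (gateOperator G a).mulVec (prodState G z ψ) (x, e) =
      ∑ t, (G a).U.1 (x, e a) (z, t) * ψ a t * ∏ b ∈ Finset.univ.erase a, ψ b (e b) := by
    simp only [Matrix.mulVec, dotProduct, Fintype.sum_prod_type, gateOperator, Matrix.of_apply,
      prodState, mul_ite, mul_zero, ite_mul, zero_mul]
    rw [Finset.sum_eq_single z (by intro y _ hy; simp [hy]) (by simp)]
    simp only [if_true]
    rw [hsum]
    simp only [hprod, herase, Function.update_self, mul_assoc]
  rw [lhs]
  simp only [Finset.sum_apply, prodState, Finset.sum_ite_eq, Finset.mem_univ, if_true]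
  rw [hprod, herase', Function.update_self]
  simp only [Matrix.mulVec, dotProduct, PurifiedChannel.block, Matrix.of_apply, Finset.sum_mul]

theorem wordOperator_nil_mulVec (Φ : ι × GlobalEnv G → ℂ) :
    (wordOperator G []).mulVec Φ = Φ :=
  Matrix.one_mulVec Φ

theorem wordOperator_cons_mulVec_prodState (a : Γ) (w : List Γ) (z : ι)
    (ψ : (a : Γ) → (G a).env → ℂ) :
    (wordOperator G (a :: w)).mulVec (prodState G z ψ) =
      ∑ l, (wordOperator G w).mulVec
        (prodState G l (Function.update ψ a (((G a).block l z).mulVec (ψ a)))) := by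
  rw [wordOperator, ← Matrix.mulVec_mulVec, gateOperator_mulVec_prodState, Matrix.mulVec_sum]

/-- If two families of channels differ at a single gate `h`, and the two channels at `h` cannot be
distinguished by histories of the lengths that occur in the words `w` and `w'`, then these words
cannot distinguish the two families. -/
theorem envGram_wordOperator_congr {G G' : Γ → PurifiedChannel.{u, v} ι} {h : Γ}
    (hG : ∀ a, a ≠ h → G a = G' a) {k l : ℕ}
    (hh : ∀ s t : List (ι × ι), s.length = k → t.length = l →
      (G h).historyGram s t = (G' h).historyGram s t) (w w' : List Γ) :
    ∀ S S' : Γ → List (ι × ι), (S h).length + w.count h = k → (S' h).length + w'.count h = l →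
      ∀ z z' x y : ι,
      envGram G ((wordOperator G w).mulVec (prodState G z fun a => (G a).history (S a)))
          ((wordOperator G w').mulVec (prodState G z' fun a => (G a).history (S' a))) x y =
        envGram G' ((wordOperator G' w).mulVec (prodState G' z fun a => (G' a).history (S a)))
          ((wordOperator G' w').mulVec (prodState G' z' fun a => (G' a).history (S' a))) x y := by
  -- The invariant of the induction: reading a letter `h` moves one unit from the remaining word to
  -- the history at `h`, and other letters change neither.
  have hlen : ∀ (S : Γ → List (ι × ι)) (a : Γ) (p : ι × ι) (w : List Γ) (m : ℕ),
      (S h).length + (a :: w).count h = m →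
        (Function.update S a (p :: S a) h).length + w.count h = m := by
    intro S a p w m hm
    by_cases ha : h = a
    · subst ha
      simp only [List.count_cons_self, Function.update_self, List.length_cons] at hm ⊢
      omega
    · rw [List.count_cons_of_ne (Ne.symm ha)] at hm
      rwa [Function.update_of_ne ha]
  induction w with
  | nil =>
    induction w' with
    | nil =>
      intro S S' hS hS' z z' x y
      simp only [wordOperator_nil_mulVec, envGram_prodState]
      refine if_congr Iff.rfl (Finset.prod_congr rfl fun a _ => ?_) rfl
      -- Both words are used up, so the histories at `h` have lengths exactly `k` and `l`; at every
      -- other gate the channels agree.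
      change (G a).historyGram (S a) (S' a) = (G' a).historyGram (S a) (S' a)
      by_cases ha : a = h
      · subst ha
        exact hh _ _ (by simpa using hS) (by simpa using hS')
      · rw [hG a ha]
    | cons a w' ih =>
      intro S S' hS hS' z z' x y
      simp only [wordOperator_cons_mulVec_prodState, envGram_sum_right]
      refine Finset.sum_congr rfl fun m _ => ?_
      rw [update_history G S' a (m, z'), update_history G' S' a (m, z')]
      exact ih S _ hS (hlen _ _ _ _ _ hS') _ _ _ _
  | cons a w ih =>
    intro S S' hS hS' z z' x y
    rw [wordOperator_cons_mulVec_prodState, wordOperator_cons_mulVec_prodState, envGram_sum_left,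
      envGram_sum_left]
    refine Finset.sum_congr rfl fun m _ => ?_
    rw [update_history G S a (m, z), update_history G' S a (m, z)]
    exact ih _ S' (hlen _ _ _ _ _ hS) hS' _ _ _ _

end ProductStates

/-! ### Reduction of the semantics to Gram entries. -/

namespace BareDiagram

variable {ι : Type u} [Fintype ι] [DecidableEq ι] {n : ℕ}

/-- The state that results from the word `w` on the data `|z⟩`. -/
def wordState {Γ : Type} [Fintype Γ] [DecidableEq Γ] (G : Γ → PurifiedChannel.{u, v} ι)
    (w : List Γ) (z : ι) : ι × GlobalEnv G → ℂ :=
  (wordOperator G w).mulVec (prodState G z fun a => (G a).history [])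

theorem sum_diagramOperator_mul_globalState (D : BareDiagram n)
    (G : D.Gate → PurifiedChannel.{u, v} ι) (x y : Pol × Fin n × ι) (e : GlobalEnv G) :
    ∑ f, D.diagramOperator G (x, e) (y, f) * globalState G f =
      if (x.1, x.2.1) = (D.run (y.1, y.2.1)).2 then
        wordState G (D.run (y.1, y.2.1)).1 y.2.2 (x.2.2, e) else 0 := by
  simp only [diagramOperator, Matrix.of_apply]
  split_ifs with h
  · simp [wordState, Matrix.mulVec, dotProduct, Fintype.sum_prod_type, prodState_history_nil]
  · simp

theorem superoperatorKernel_diagramOperator (D : BareDiagram n)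
    (G : D.Gate → PurifiedChannel.{u, v} ι) (x x' y y' : Pol × Fin n × ι) :
    superoperatorKernel (D.diagramOperator G) (globalState G) x x' y y' =
      if (x.1, x.2.1) = (D.run (y.1, y.2.1)).2 ∧ (x'.1, x'.2.1) = (D.run (y'.1, y'.2.1)).2 then
        envGram G (wordState G (D.run (y.1, y.2.1)).1 y.2.2)
          (wordState G (D.run (y'.1, y'.2.1)).1 y'.2.2) x.2.2 x'.2.2
      else 0 := by
  simp only [superoperatorKernel, sum_diagramOperator_mul_globalState]
  by_cases h : (x.1, x.2.1) = (D.run (y.1, y.2.1)).2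
  · by_cases h' : (x'.1, x'.2.1) = (D.run (y'.1, y'.2.1)).2
    · simp only [h, h', if_true, and_self, envGram]
    · simp [h']
  · simp [h]

/-- Words and final configurations depend on `D` alone, so two families can differ only in the Gram
entries of the word states. -/
theorem semantics_eq_iff {D : BareDiagram n} {G G' : D.Gate → PurifiedChannel.{u, v} ι} :
    D.semantics G = D.semantics G' ↔ ∀ (s t : Pol × Fin n) (z z' x x' : ι),
      envGram G (wordState G (D.run s).1 z) (wordState G (D.run t).1 z') x x' =
        envGram G' (wordState G' (D.run s).1 z) (wordState G' (D.run t).1 z') x x' := by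
  rw [semantics, semantics, superoperator_eq_iff]
  simp only [superoperatorKernel_diagramOperator]
  constructor
  · intro h s t z z' x x'
    simpa using h ((D.run s).2.1, (D.run s).2.2, x) ((D.run t).2.1, (D.run t).2.2, x')
      (s.1, s.2, z) (t.1, t.2, z')
  · intro h x x' y y'
    split_ifs
    · exact h ..
    · rfl

end BareDiagram

/-! ### Counting the crossings of a gate. -/

namespace BareDiagram

/-- Different runs of `feedback` meet different states: an additive weight of words has at most the
same total for `feedback` as for one round. -/
theorem sum_feedback_le {G : Type} {n : ℕ}
    (f : Pol × Fin (n + 1) → List G × (Pol × Fin (n + 1)))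
    (hf : Function.Injective fun s => (f s).2) (μ : List G → ℕ)
    (hμ : ∀ w w', μ (w ++ w') = μ w + μ w') :
    ∑ s : Pol × Fin n, μ (feedback f s.2 3 (s.1, s.2.castSucc)).1 ≤ ∑ t, μ (f t).1 := by
  classical
  have hf' : ∀ {x y}, (f x).2 = (f y).2 → x = y := fun h => hf h
  set m : Pol × Fin (n + 1) → ℕ := fun t => μ (f t).1
  set g : Pol × Fin (n + 1) → Pol × Fin (n + 1) := fun s => (f s).2
  let emb : Pol × Fin n → Pol × Fin (n + 1) := fun s => (s.1, s.2.castSucc)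
  have hemb : Function.Injective emb := by
    rintro ⟨c, p⟩ ⟨d, q⟩ h
    simpa [emb] using h
  -- `S₀`, `S₁`, `S₂` are the states in which the first, second and third rounds start;
  -- `not_three_loops` excludes a fourth.
  let S₀ : Finset (Pol × Fin (n + 1)) := Finset.univ.image emb
  let S₁ := (S₀.filter fun t => (g t).2 = Fin.last n).image g
  let S₂ := (S₁.filter fun t => (g t).2 = Fin.last n).image g
  have hbound : ∀ s : Pol × Fin n, μ (feedback f s.2 3 (s.1, s.2.castSucc)).1 =
      m (emb s) + if (g (emb s)).2 = Fin.last n then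
        m (g (emb s)) + (if (g (g (emb s))).2 = Fin.last n then m (g (g (emb s))) else 0)
        else 0 := by
    rintro ⟨c, p⟩
    have ls := not_three_loops f hf c p
    simp only [feedback, emb, m, g]
    split_ifs with a₁ a₂ a₃
    · exact absurd a₃ (ls a₁ a₂)
    · simp [hμ]
    · simp [hμ]
    · simp
  have h₀ : ∀ F : Pol × Fin (n + 1) → ℕ, ∑ s, F (emb s) = ∑ t ∈ S₀, F t := fun F =>
    (Finset.sum_image hemb.injOn).symm
  have himage : ∀ (F : Pol × Fin (n + 1) → ℕ) (S : Finset (Pol × Fin (n + 1))),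
      ∑ t ∈ S, (if (g t).2 = Fin.last n then F (g t) else 0) =
        ∑ t ∈ (S.filter fun t => (g t).2 = Fin.last n).image g, F t := by
    intro F S
    rw [Finset.sum_image hf.injOn, Finset.sum_filter]
  have hlast₁ : ∀ t ∈ S₁, t.2 = Fin.last n := by
    intro t ht
    simp only [S₁, Finset.mem_image, Finset.mem_filter] at ht
    obtain ⟨s, hs, rfl⟩ := ht
    exact hs.2
  have hlast₂ : ∀ t ∈ S₂, t.2 = Fin.last n := by
    intro t ht
    simp only [S₂, Finset.mem_image, Finset.mem_filter] at ht
    obtain ⟨s, hs, rfl⟩ := ht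
    exact hs.2
  have hlast₀ : ∀ t ∈ S₀, t.2 ≠ Fin.last n := by
    intro t ht
    simp only [S₀, Finset.mem_image] at ht
    obtain ⟨s, _, rfl⟩ := ht
    exact Fin.castSucc_ne_last _
  have d₀₁ : Disjoint S₀ S₁ :=
    Finset.disjoint_left.mpr fun t h h' => hlast₀ t h (hlast₁ t h')
  have d₀₂ : Disjoint S₀ S₂ :=
    Finset.disjoint_left.mpr fun t h h' => hlast₀ t h (hlast₂ t h')
  -- A common element would have, by injectivity of `g`, one preimage lying in both `S₀` and `S₁`.
  have d₁₂ : Disjoint S₁ S₂ := by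
    refine Finset.disjoint_left.mpr fun t h h' => ?_
    simp only [S₁, Finset.mem_image, Finset.mem_filter] at h
    obtain ⟨s, ⟨hs, -⟩, rfl⟩ := h
    rw [Finset.mem_image] at h'
    obtain ⟨s', hs', he⟩ := h'
    rw [hf' he, Finset.mem_filter] at hs'
    exact Finset.disjoint_left.mp d₀₁ hs hs'.1
  calc ∑ s : Pol × Fin n, μ (feedback f s.2 3 (s.1, s.2.castSucc)).1
      = ∑ t ∈ S₀, m t + (∑ t ∈ S₁, m t + ∑ t ∈ S₂, m t) := by
        rw [Finset.sum_congr rfl fun s _ => hbound s, Finset.sum_add_distrib, h₀ m,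
          h₀ fun t => if (g t).2 = Fin.last n then
            m (g t) + (if (g (g t)).2 = Fin.last n then m (g (g t)) else 0) else 0,
          himage (fun t => m t + if (g t).2 = Fin.last n then m (g t) else 0),
          Finset.sum_add_distrib, himage m]
    _ = ∑ t ∈ S₀ ∪ (S₁ ∪ S₂), m t := by
        rw [Finset.sum_union (Finset.disjoint_union_right.mpr ⟨d₀₁, d₀₂⟩), Finset.sum_union d₁₂]
    _ ≤ ∑ t, m t := Finset.sum_le_sum_of_subset (Finset.subset_univ _)

theorem count_map_append_left {α β γ : Type} [DecidableEq α] [DecidableEq γ] {i : α → γ}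
    {j : β → γ} (hi : Function.Injective i) (hij : ∀ a b, j b ≠ i a) (a : α) (w : List α)
    (w' : List β) : (w.map i ++ w'.map j).count (i a) = w.count a := by
  have h : (w'.map j).count (i a) = 0 := List.count_eq_zero.mpr (by simp [hij])
  rw [List.count_append, List.count_map_of_injective _ _ hi, h, add_zero]

theorem count_map_append_right {α β γ : Type} [DecidableEq β] [DecidableEq γ] {i : α → γ}
    {j : β → γ} (hj : Function.Injective j) (hij : ∀ a b, i a ≠ j b) (b : β) (w : List α)
    (w' : List β) : (w.map i ++ w'.map j).count (j b) = w'.count b := by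
  have h : (w.map i).count (j b) = 0 := List.count_eq_zero.mpr (by simp [hij])
  rw [List.count_append, List.count_map_of_injective _ _ hj, h, zero_add]

theorem run_bijective {n : ℕ} (D : BareDiagram n) : Function.Bijective fun s => (D.run s).2 :=
  Finite.injective_iff_bijective.mp D.run_injective

theorem sum_run_par {n m : ℕ} (D₁ : BareDiagram n) (D₂ : BareDiagram m)
    (μ : List (D₁.Gate ⊕ D₂.Gate) → ℕ) :
    ∑ s, μ ((par D₁ D₂).run s).1 =
      ∑ s, μ ((D₁.run s).1.map Sum.inl) + ∑ s, μ ((D₂.run s).1.map Sum.inr) := by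
  simp only [Fintype.sum_prod_type, Fin.sum_univ_add, ← Finset.sum_add_distrib, run,
    Fin.addCases_left, Fin.addCases_right]

/-- Each gate is crossed at most once in each polarisation, hence at most twice in total. -/
theorem sum_count_run_le {n : ℕ} (D : BareDiagram n) :
    ∀ a : D.Gate, ∑ s, (D.run s).1.count a ≤ 2 := by
  induction D with
  | empty | wire | neg | swap | pbs => rintro ⟨⟩
  | gate =>
    rintro ⟨⟩
    -- One crossing for each of the two polarisations: the bound 2 is attained.
    decide
  | comp D₂ D₁ ih₂ ih₁ =>
    rintro (a | a)
    · refine le_of_eq_of_le (Finset.sum_congr rfl fun s _ => ?_) (ih₁ a)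
      exact count_map_append_left (γ := (comp D₂ D₁).Gate) Sum.inl_injective
        (fun _ _ => Sum.inr_ne_inl) a _ _
    -- The inputs of `D₂` are the outputs of `D₁`, which run over all configurations exactly once.
    · refine le_of_eq_of_le (Eq.trans ?_
        (D₁.run_bijective.sum_comp fun t => (D₂.run t).1.count a)) (ih₂ a)
      exact Finset.sum_congr rfl fun s _ => count_map_append_right (γ := (comp D₂ D₁).Gate)
        Sum.inr_injective (fun _ _ => Sum.inl_ne_inr) a _ _
  | par D₁ D₂ ih₁ ih₂ =>
    rintro (a | a)
    · refine le_of_eq_of_le ?_ (ih₁ a)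
      refine (sum_run_par D₁ D₂ fun w =>
        List.count (α := (par D₁ D₂).Gate) (Sum.inl a) w).trans ?_
      refine (congrArg₂ _ (Finset.sum_congr rfl fun s _ => ?_)
        (Finset.sum_eq_zero fun s _ => ?_)).trans (add_zero _)
      · exact List.count_map_of_injective (β := (par D₁ D₂).Gate) _ _ Sum.inl_injective _
      · refine List.count_eq_zero.mpr fun h => ?_
        obtain ⟨b, _, hb⟩ := List.mem_map.mp h
        exact Sum.inr_ne_inl hb
    · refine le_of_eq_of_le ?_ (ih₂ a)
      refine (sum_run_par D₁ D₂ fun w =>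
        List.count (α := (par D₁ D₂).Gate) (Sum.inr a) w).trans ?_
      refine (congrArg₂ _ (Finset.sum_eq_zero fun s _ => ?_)
        (Finset.sum_congr rfl fun s _ => ?_)).trans (zero_add _)
      · refine List.count_eq_zero.mpr fun h => ?_
        obtain ⟨b, _, hb⟩ := List.mem_map.mp h
        exact Sum.inl_ne_inr hb
      · exact List.count_map_of_injective (β := (par D₁ D₂).Gate) _ _ Sum.inr_injective _
  | trace D ih =>
    exact fun a => (sum_feedback_le D.run D.run_injective (fun w => w.count a)
      fun _ _ => List.count_append).trans (ih a)

/-- Different inputs share the total of two crossings; equal inputs have equal counts, each at most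
two. -/
theorem usePair_run {n : ℕ} (D : BareDiagram n) (a : D.Gate) (s t : Pol × Fin n) :
    PurifiedChannel.UsePair ((D.run s).1.count a) ((D.run t).1.count a) := by
  have h := D.sum_count_run_le a
  by_cases hst : s = t
  · subst hst
    have h₁ := Finset.single_le_sum (f := fun s => (D.run s).1.count a) (fun _ _ => Nat.zero_le _)
      (Finset.mem_univ s)
    have h₂ := h₁.trans h
    simp only [PurifiedChannel.UsePair]
    omega
  · left
    have h₁ := Finset.sum_le_sum_of_subset (f := fun s => (D.run s).1.count a)
      (Finset.subset_univ {s, t})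
    rw [Finset.sum_pair hst] at h₁
    exact h₁.trans h

variable {ι : Type u} [Fintype ι] [DecidableEq ι] {n : ℕ}

theorem semantics_congr (D : BareDiagram n) (h : D.Gate)
    {G G' : D.Gate → PurifiedChannel.{u, v} ι} (hG : ∀ a, a ≠ h → G a = G' a)
    (h₁ : (G h).T₁ = (G' h).T₁) (h₂ : (G h).S₂ = (G' h).S₂) (h₃ : (G h).T₂ = (G' h).T₂) :
    D.semantics G = D.semantics G' := by
  rw [semantics_eq_iff]
  intro s t z z' x x'
  refine envGram_wordOperator_congr hG (fun l r hl hr => ?_) _ _ (fun _ => []) (fun _ => [])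
    (zero_add _) (zero_add _) z z' x x'
  refine PurifiedChannel.historyGram_eq_of_usePair h₁ h₂ h₃ l r ?_
  rw [hl, hr]
  exact D.usePair_run h s t

end BareDiagram

/-! ### Substitution into contexts. -/

/-- Bare diagrams together with a family of purified channels that fills their gates. -/
abbrev FilledDiagram (ι : Type u) [Fintype ι] [DecidableEq ι] (n : ℕ) : Type (max u (v + 1)) :=
  Σ D : BareDiagram n, D.Gate → PurifiedChannel.{u, v} ι

namespace FilledDiagram

variable {ι : Type u} [Fintype ι] [DecidableEq ι]

/-- These operations mirror the constructors of `ExtDiagram`. An equality of pairs passes through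
them by `congrArg`, whereas the families alone have types that depend on the bare diagram. -/
def comp {n : ℕ} (D₂ D₁ : FilledDiagram.{u, v} ι n) : FilledDiagram.{u, v} ι n :=
  ⟨.comp D₂.1 D₁.1, Sum.elim D₁.2 D₂.2⟩

def par {n m : ℕ} (D₁ : FilledDiagram.{u, v} ι n) (D₂ : FilledDiagram.{u, v} ι m) :
    FilledDiagram.{u, v} ι (n + m) :=
  ⟨.par D₁.1 D₂.1, Sum.elim D₁.2 D₂.2⟩

def trace {n : ℕ} (D : FilledDiagram.{u, v} ι (n + 1)) : FilledDiagram.{u, v} ι n :=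
  ⟨.trace D.1, D.2⟩

end FilledDiagram

/-- The filled bare diagram that underlies an extended diagram. -/
def ExtDiagram.filled {ι : Type u} [Fintype ι] [DecidableEq ι] {n : ℕ}
    (D : ExtDiagram.{u, v} ι n) : FilledDiagram.{u, v} ι n :=
  ⟨D.bare, D.family⟩

namespace Context

variable {ι : Type u} [Fintype ι] [DecidableEq ι]

/-- The two substitution instances of a context have the same bare diagram, and the families of
their gates differ at most at one gate. -/
theorem exists_family_subst {n : ℕ} (C : Context.{u, v} ι n) (P Q : PurifiedChannel.{u, v} ι) :
    ∃ (D : BareDiagram n) (h : D.Gate) (G G' : D.Gate → PurifiedChannel.{u, v} ι),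
      (∀ a, a ≠ h → G a = G' a) ∧ G h = P ∧ G' h = Q ∧
      (C.subst P).filled = ⟨D, G⟩ ∧ (C.subst Q).filled = ⟨D, G'⟩ := by
  induction C with
  | hole =>
    exact ⟨.gate, (), fun _ => P, fun _ => Q, fun _ ha => absurd rfl ha, rfl, rfl, rfl, rfl⟩
  | compLeft E C ih =>
    obtain ⟨D, h, G, G', hG, h₁, h₂, e₁, e₂⟩ := ih
    refine ⟨.comp E.bare D, Sum.inl h, Sum.elim G E.family, Sum.elim G' E.family, ?_, h₁, h₂,
      congrArg (E.filled.comp ·) e₁, congrArg (E.filled.comp ·) e₂⟩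
    rintro (a | a) ha
    · exact hG a fun h => ha (congrArg _ h)
    · rfl
  | compRight C E ih =>
    obtain ⟨D, h, G, G', hG, h₁, h₂, e₁, e₂⟩ := ih
    refine ⟨.comp D E.bare, Sum.inr h, Sum.elim E.family G, Sum.elim E.family G', ?_, h₁, h₂,
      congrArg (FilledDiagram.comp · E.filled) e₁, congrArg (FilledDiagram.comp · E.filled) e₂⟩
    rintro (a | a) ha
    · rfl
    · exact hG a fun h => ha (congrArg _ h)
  | parLeft E C ih =>
    obtain ⟨D, h, G, G', hG, h₁, h₂, e₁, e₂⟩ := ih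
    refine ⟨.par E.bare D, Sum.inr h, Sum.elim E.family G, Sum.elim E.family G', ?_, h₁, h₂,
      congrArg (E.filled.par ·) e₁, congrArg (E.filled.par ·) e₂⟩
    rintro (a | a) ha
    · rfl
    · exact hG a fun h => ha (congrArg _ h)
  | parRight C E ih =>
    obtain ⟨D, h, G, G', hG, h₁, h₂, e₁, e₂⟩ := ih
    refine ⟨.par D E.bare, Sum.inl h, Sum.elim G E.family, Sum.elim G' E.family, ?_, h₁, h₂,
      congrArg (FilledDiagram.par · E.filled) e₁, congrArg (FilledDiagram.par · E.filled) e₂⟩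
    rintro (a | a) ha
    · exact hG a fun h => ha (congrArg _ h)
    · rfl
  | trace C ih =>
    obtain ⟨D, h, G, G', hG, h₁, h₂, e₁, e₂⟩ := ih
    exact ⟨.trace D, h, G, G', hG, h₁, h₂, congrArg (FilledDiagram.trace ·) e₁,
      congrArg (FilledDiagram.trace ·) e₂⟩

theorem semantics_subst_congr {n : ℕ} (C : Context.{u, v} ι n) {P Q : PurifiedChannel.{u, v} ι}
    (h₁ : P.T₁ = Q.T₁) (h₂ : P.S₂ = Q.S₂) (h₃ : P.T₂ = Q.T₂) :
    (C.subst P).semantics = (C.subst Q).semantics := by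
  obtain ⟨D, h, G, G', hG, rfl, rfl, e₁, e₂⟩ := C.exists_family_subst P Q
  have hs : ∀ D : FilledDiagram.{u, v} ι n, ∀ E : ExtDiagram.{u, v} ι n, E.filled = D →
      E.semantics = D.1.semantics D.2 := by
    rintro _ E rfl
    rfl
  rw [hs _ _ e₁, hs _ _ e₂]
  exact D.semantics_congr h hG h₁ h₂ h₃

end Context

/-! ### Channels that permute basis vectors. -/

namespace PurifiedChannel

variable {ι : Type u} [Fintype ι] [DecidableEq ι]

/-- The evolution of `P` sends the basis vector `s` of the joint system to the basis vector `t`. -/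
def Moves (P : PurifiedChannel.{u, v} ι) (s t : ι × P.env) : Prop :=
  ∀ x, (P.block x s.1).mulVec (Pi.single s.2 1) = if x = t.1 then Pi.single t.2 1 else 0

/-- The channel whose evolution permutes the basis vectors of the joint system. -/
noncomputable def ofPerm (M : Type v) [Fintype M] [DecidableEq M] (m₀ : M) (σ : Equiv.Perm (ι × M)) :
    PurifiedChannel.{u, v} ι where
  env := M
  ε := EuclideanSpace.single m₀ 1
  norm_ε := by simp
  U := ⟨Matrix.of fun x y => if x = σ y then 1 else 0, by
    rw [Matrix.mem_unitaryGroup_iff']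
    ext x y
    simp [Matrix.mul_apply, Matrix.one_apply, Matrix.star_apply, eq_comm]⟩

theorem moves_ofPerm (M : Type v) [Fintype M] [DecidableEq M] (m₀ : M)
    (σ : Equiv.Perm (ι × M)) (s : ι × M) : (ofPerm M m₀ σ).Moves s (σ s) := by
  intro x
  rw [Matrix.mulVec_single_one]
  refine funext fun m : M => ?_
  change (if (x, m) = σ s then (1 : ℂ) else 0) =
    (if x = (σ s).1 then (Pi.single (σ s).2 1 : M → ℂ) else 0) m
  by_cases h : x = (σ s).1 <;> simp [h, Prod.ext_iff, Pi.single_apply]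

/-- Every partial injection of basis vectors is implemented by a purified channel. -/
theorem exists_moves {M : Type u} [Fintype M] [DecidableEq M] (m₀ : M) {s : Set (ι × M)}
    {f : ι × M → ι × M} (hf : Set.InjOn f s) :
    ∃ (P : PurifiedChannel.{u, v} ι) (e : M → P.env), Function.Injective e ∧
      P.history [] = Pi.single (e m₀) 1 ∧
      ∀ x ∈ s, P.Moves (x.1, e x.2) ((f x).1, e (f x).2) := by
  -- On a finite set a partial injection extends to a permutation, whose matrix is unitary.
  obtain ⟨g, hg⟩ := Set.MapsTo.exists_equiv_extend_of_card_eq (f := f) (s := s)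
    (t := Finset.univ) rfl (fun _ _ => Finset.mem_coe.mpr (Finset.mem_univ _)) hf
  let τ : Equiv.Perm (ι × M) := g.trans (Equiv.subtypeUnivEquiv fun _ => Finset.mem_univ _)
  -- `M` lives in universe `u` and environments in universe `v`, so a copy of `M` is used.
  let e : M ≃ ULift.{v} (Fin (Fintype.card M)) := (Fintype.equivFin M).trans Equiv.ulift.symm
  let E : ι × M ≃ ι × ULift.{v} (Fin (Fintype.card M)) := Equiv.prodCongr (Equiv.refl ι) e
  refine ⟨ofPerm _ (e m₀) ((E.symm.trans τ).trans E), e, e.injective, ?_, fun x hx => ?_⟩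
  · exact PiLp.ofLp_single 2 (e m₀) 1
  · have h := moves_ofPerm _ (e m₀) ((E.symm.trans τ).trans E) (x.1, e x.2)
    have h' : (E.symm.trans τ).trans E (x.1, e x.2) = ((f x).1, e (f x).2) := by
      rw [← hg x hx]
      simp [E, τ, Prod.map]
    rwa [h'] at h

end PurifiedChannel

/-! ### Two memories around a gate. -/

section ThreeGates

variable {ι : Type u} [Fintype ι] [DecidableEq ι] {Γ : Type} [DecidableEq Γ]
  (G : Γ → PurifiedChannel.{u, v} ι)

/-- The environment state `v` at the gate `a`, the basis states `m` and `n` at the gates `b` and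
`c`, and the initial state at all other gates. -/
def threeState (a b c : Γ) (v : (G a).env → ℂ) (m : (G b).env) (n : (G c).env) :
    (g : Γ) → (G g).env → ℂ :=
  Function.update (Function.update (Function.update (fun g => (G g).history []) a v)
    b (Pi.single m 1)) c (Pi.single n 1)

variable {G} {a b c : Γ} {v v' : (G a).env → ℂ} {m m' : (G b).env} {n n' : (G c).env}

theorem threeState_a (hab : a ≠ b) (hac : a ≠ c) : threeState G a b c v m n a = v := by
  simp [threeState, hab, hac]

theorem threeState_b (hbc : b ≠ c) : threeState G a b c v m n b = Pi.single m 1 := by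
  simp [threeState, hbc]

theorem threeState_c : threeState G a b c v m n c = Pi.single n 1 := by
  simp [threeState]

theorem update_threeState_a (hab : a ≠ b) (hac : a ≠ c) : Function.update (threeState G a b c v m n) a v' =
    threeState G a b c v' m n := by
  rw [threeState, Function.update_comm hac.symm, Function.update_comm hab.symm,
    Function.update_idem]
  rfl

theorem update_threeState_b (hbc : b ≠ c) : Function.update (threeState G a b c v m n) b (Pi.single m' 1) =
    threeState G a b c v m' n := by
  rw [threeState, Function.update_comm hbc.symm, Function.update_idem]
  rfl

theorem update_threeState_c : Function.update (threeState G a b c v m n) c (Pi.single n' 1) =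
    threeState G a b c v m n' := by
  rw [threeState, Function.update_idem]
  rfl

variable {β₀ : (G b).env} {γ₀ : (G c).env}

theorem threeState_initial (hβ : (G b).history [] = Pi.single β₀ 1)
    (hγ : (G c).history [] = Pi.single γ₀ 1) :
    threeState G a b c ((G a).history []) β₀ γ₀ = fun g => (G g).history [] := by
  rw [threeState, ← hβ, ← hγ]
  simp only [Function.update_eq_self]

variable [Fintype Γ]

theorem prodState_update_zero (G : Γ → PurifiedChannel.{u, v} ι) (a : Γ) (z : ι) (ψ : (a : Γ) → (G a).env → ℂ) :
    prodState G z (Function.update ψ a 0) = 0 := by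
  ext x
  simp only [prodState, Pi.zero_apply, ite_eq_right_iff]
  exact fun _ => Finset.prod_eq_zero (Finset.mem_univ a) (by simp)

/-- A deterministic move leaves a single branch: for every other output the factor at `a` is zero.
-/
theorem wordOperator_cons_mulVec_of_moves (G : Γ → PurifiedChannel.{u, v} ι) {a : Γ} (w : List Γ) {z z' : ι} {m m' : (G a).env}
    (ψ : (a : Γ) → (G a).env → ℂ) (hψ : ψ a = Pi.single m 1)
    (h : (G a).Moves (z, m) (z', m')) :
    (wordOperator G (a :: w)).mulVec (prodState G z ψ) =
      (wordOperator G w).mulVec (prodState G z' (Function.update ψ a (Pi.single m' 1))) := by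
  rw [wordOperator_cons_mulVec_prodState, Finset.sum_eq_single z' _ (by simp), hψ, h z',
    if_pos rfl]
  intro l _ hl
  rw [hψ, h l, if_neg hl, prodState_update_zero, Matrix.mulVec_zero]

theorem prod_threeState (hab : a ≠ b) (hac : a ≠ c) (hbc : b ≠ c) :
    ∏ g, ∑ e, threeState G a b c v m n g e * star (threeState G a b c v' m' n' g e) =
      if m = m' ∧ n = n' then ∑ e, v e * star (v' e) else 0 := by
  -- All other gates are in their initial unit vectors and contribute the factor 1.
  rw [← Finset.prod_subset (Finset.subset_univ {a, b, c})]
  · rw [Finset.prod_insert (by simp [hab, hac]), Finset.prod_pair hbc]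
    simp only [threeState_a hab hac, threeState_b hbc, threeState_c]
    by_cases hm : m = m' <;> by_cases hn : n = n' <;>
      simp [Pi.single_apply, hm, hn, eq_comm]
  · intro g _ hg
    simp only [Finset.mem_insert, Finset.mem_singleton, not_or] at hg
    have h : ∀ v m n, threeState G a b c v m n g = (G g).history [] := by
      intro v m n
      simp [threeState, hg]
    simp only [h]
    exact (G g).historyGram_nil

/-- Two memories `b` and `c` around two uses of `a`: the first memory provides the input of the
second use, and the second memory keeps the output of the first use. -/
theorem wordState_two_memories (hab : a ≠ b) (hac : a ≠ c) (hbc : b ≠ c) (hβ : (G b).history [] = Pi.single β₀ 1)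
    (hγ : (G c).history [] = Pi.single γ₀ 1) {x j k x₀ : ι} {βm : (G b).env}
    {γm : ι → (G c).env} {out : ι × ι → ι × (G c).env}
    (hb₁ : (G b).Moves (x, β₀) (j, βm)) (hb₂ : (G b).Moves (x₀, βm) (k, β₀))
    (hc₁ : ∀ l, (G c).Moves (l, γ₀) (x₀, γm l))
    (hc₂ : ∀ i l, (G c).Moves (i, γm l) (out (i, l))) :
    BareDiagram.wordState G [b, a, c, b, a, c] x = ∑ p : ι × ι, prodState G (out p).1
      (threeState G a b c ((G a).history [(p.1, k), (p.2, j)]) β₀ (out p).2) := by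
  rw [BareDiagram.wordState, ← threeState_initial hβ hγ (a := a),
    wordOperator_cons_mulVec_of_moves G _ _ (threeState_b hbc) hb₁, update_threeState_b hbc,
    -- In `p = (i, l)` the output `l` of the first use is the second component, so the sums are
    -- exchanged to follow the order of time.
    wordOperator_cons_mulVec_prodState, Fintype.sum_prod_type, Finset.sum_comm]
  refine Finset.sum_congr rfl fun l _ => ?_
  rw [threeState_a hab hac, update_threeState_a hab hac,
    wordOperator_cons_mulVec_of_moves G _ _ threeState_c (hc₁ l), update_threeState_c,
    wordOperator_cons_mulVec_of_moves G _ _ (threeState_b hbc) hb₂, update_threeState_b hbc,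
    wordOperator_cons_mulVec_prodState]
  refine Finset.sum_congr rfl fun i _ => ?_
  rw [threeState_a hab hac, update_threeState_a hab hac,
    wordOperator_cons_mulVec_of_moves G _ _ threeState_c (hc₂ i l), update_threeState_c,
    wordOperator_nil_mulVec]
  rfl

/-- The memory `b` has returned to `β₀` in every branch. Fixing the data outputs and tracing out `c`
keeps only pairs of branches with a common label, and `hout` leaves just `(p₀, p₀')`. -/
theorem envGram_two_memories (hab : a ≠ b) (hac : a ≠ c) (hbc : b ≠ c) {F F' : ι × ι → (G a).env → ℂ} {out : ι × ι → ι × (G c).env}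
    {p₀ p₀' : ι × ι} (h₀ : (out p₀).2 = (out p₀').2)
    (hout : ∀ p p', (out p).1 = (out p₀).1 → (out p').1 = (out p₀').1 →
      (out p).2 = (out p').2 → p = p₀ ∧ p' = p₀') :
    envGram G (∑ p, prodState G (out p).1 (threeState G a b c (F p) β₀ (out p).2))
        (∑ p, prodState G (out p).1 (threeState G a b c (F' p) β₀ (out p).2))
        (out p₀).1 (out p₀').1 = ∑ e, F p₀ e * star (F' p₀' e) := by
  simp only [envGram_sum_left]
  simp only [envGram_sum_right, envGram_prodState, prod_threeState hab hac hbc]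
  rw [Finset.sum_eq_single p₀ _ (by simp), Finset.sum_eq_single p₀' _ (by simp)]
  · simp [h₀]
  · intro p' _ hp'
    refine ite_eq_right_iff.mpr fun h => ite_eq_right_iff.mpr fun h' => ?_
    exact absurd (hout p₀ p' rfl h.2.symm h'.2).2 hp'
  · intro p _ hp
    refine Finset.sum_eq_zero fun p' _ => ?_
    refine ite_eq_right_iff.mpr fun h => ite_eq_right_iff.mpr fun h' => ?_
    exact absurd (hout p p' h.1.symm h.2.symm h'.2).1 hp

/-- The path that avoids all three gates leaves `c` in `γ₀`, so only branches labelled `γ₀` overlap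
with it; injectivity of `out` singles out `p₀`. -/
theorem envGram_two_memories_nil (hab : a ≠ b) (hac : a ≠ c) (hbc : b ≠ c) (hβ : (G b).history [] = Pi.single β₀ 1)
    (hγ : (G c).history [] = Pi.single γ₀ 1) {F : ι × ι → (G a).env → ℂ}
    {out : ι × ι → ι × (G c).env} (hinj : Function.Injective out) {p₀ : ι × ι}
    (h₀ : (out p₀).2 = γ₀) (y : ι) :
    envGram G (∑ p, prodState G (out p).1 (threeState G a b c (F p) β₀ (out p).2))
        (BareDiagram.wordState G [] y) (out p₀).1 y =
      ∑ e, F p₀ e * star ((G a).history [] e) := by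
  rw [BareDiagram.wordState, wordOperator_nil_mulVec, ← threeState_initial hβ hγ (a := a)]
  simp only [envGram_sum_left, envGram_prodState, prod_threeState hab hac hbc]
  rw [Finset.sum_eq_single p₀ _ (by simp)]
  · simp [h₀]
  · intro p _ hp
    refine ite_eq_right_iff.mpr fun h => ite_eq_right_iff.mpr fun h' => ?_
    exact absurd (hinj (Prod.ext h.1.symm (h'.2.trans h₀.symm))) hp

end ThreeGates

/-! ### Construction of the memories. -/

section Memories

variable {ι : Type u} [Fintype ι] [DecidableEq ι]

/-- Pairs need not embed into `α`, but two given pairs can be encoded: if they differ, they differ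
in a component. -/
theorem exists_ne_iff_ne {α : Type*} (p q : α × α) : ∃ x y : α, x = y ↔ p = q := by
  by_cases h : p = q
  · exact ⟨p.1, p.1, by simp [h]⟩
  · by_cases h₁ : p.1 = q.1
    · exact ⟨p.2, q.2, by simp [Prod.ext_iff, h₁]⟩
    · exact ⟨p.1, q.1, by simp [Prod.ext_iff, h₁]⟩

/-- A memory that provides the input of the second use of a gate. -/
theorem exists_input_memory (q q' : ι × ι) (x₀ : ι) :
    ∃ (B : PurifiedChannel.{u, v} ι) (β₀ : B.env) (βm : ι → B.env) (x x' : ι),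
      B.history [] = Pi.single β₀ 1 ∧ B.Moves (x, β₀) (q.1, βm q.2) ∧
      B.Moves (x', β₀) (q'.1, βm q'.2) ∧ ∀ k, B.Moves (x₀, βm k) (k, β₀) := by
  obtain ⟨x, x', hx⟩ := exists_ne_iff_ne q q'
  -- `none` is the initial memory. The first use emits `q.1` or `q'.1` and stores `q.2` or `q'.2`;
  -- the second emits the stored value and resets the memory.
  let f : ι × Option ι → ι × Option ι := fun s =>
    match s.2 with
    | none => if s.1 = x then (q.1, some q.2) else (q'.1, some q'.2)
    | some k => (k, none)
  let s : Set (ι × Option ι) := {s | s.2 = none ∧ (s.1 = x ∨ s.1 = x') ∨ s.2 ≠ none ∧ s.1 = x₀}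
  have hf : Set.InjOn f s := by
    rintro ⟨y, _ | k⟩ h ⟨y', _ | k'⟩ h' e
    · simp only [s, Set.mem_ofPred_eq] at h h'
      simp only [f] at e
      split_ifs at e with h₁ h₂ h₂
      · rw [h₁, h₂]
      -- Equal images would give `q = q'`, although `x ≠ x'`.
      · exact absurd (by simpa [Prod.ext_iff] using e) (mt hx.mpr (by grind))
      · exact absurd (by simpa [Prod.ext_iff, eq_comm] using e) (mt hx.mpr (by grind))
      · grind
    · simp only [f] at e
      split_ifs at e <;> simp at e
    · simp only [f] at e
      split_ifs at e <;> simp at e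
    · simp only [s, Set.mem_ofPred_eq] at h h'
      simp only [f, Prod.mk.injEq] at e
      simp_all
  obtain ⟨B, e, -, hε, hB⟩ := PurifiedChannel.exists_moves.{u, v} none hf
  refine ⟨B, e none, fun k => e (some k), x, x', hε, ?_, ?_, fun k => ?_⟩
  · simpa [f] using hB (x, none) (by simp [s])
  · have h := hB (x', none) (by simp [s])
    by_cases hxx : x' = x
    · have hq := hx.mp hxx.symm
      simpa [f, hxx, hq] using h
    · simpa [f, hxx] using h
  · simpa [f] using hB (x₀, some k) (by simp [s])

/-- An injective labelling `out` that gives `p₀` and `p₀'` the label `none`, and for which the first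
components of `out p` and `out p'` together with a common label determine `p` and `p'`. -/
theorem exists_labelling (p₀ p₀' : ι × ι) :
    ∃ out : ι × ι → ι × Option (ι × ι), Function.Injective out ∧
      (out p₀).2 = none ∧ (out p₀').2 = none ∧
      ∀ p p', (out p).1 = (out p₀).1 → (out p').1 = (out p₀').1 → (out p).2 = (out p').2 →
        p = p₀ ∧ p' = p₀' := by
  obtain ⟨x, x', hx⟩ := exists_ne_iff_ne p₀ p₀'
  -- `y` is the data output of the remaining pairs. Two branches with the same label `some p` would
  -- both output `y`, so `y` must miss `x` or `x'`. If `ι` has one element, no pairs remain.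
  obtain ⟨y, hy⟩ : ∃ y, ∀ p, p = p₀ ∨ p = p₀' ∨ y ≠ x ∨ y ≠ x' := by
    by_cases h : ∃ y, y ≠ x
    · obtain ⟨y, hy⟩ := h
      exact ⟨y, fun _ => .inr (.inr (.inl hy))⟩
    · push Not at h
      exact ⟨x, fun p => .inl (Prod.ext ((h _).trans (h _).symm) ((h _).trans (h _).symm))⟩
  let out : ι × ι → ι × Option (ι × ι) := fun p =>
    if p = p₀ then (x, none) else if p = p₀' then (x', none) else (y, some p)
  refine ⟨out, ?_, ?_, ?_, ?_⟩
  · intro p p' h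
    simp only [out] at h
    split_ifs at h <;> grind
  · simp [out]
  · simp only [out]
    split_ifs <;> rfl
  · intro p p' h h' e
    have := hy p
    simp only [out] at h h' e
    split_ifs at h h' e <;> grind

/-- A memory that keeps the output of the first use of a gate. -/
theorem exists_output_memory (p₀ p₀' : ι × ι) (x₀ : ι) :
    ∃ (C : PurifiedChannel.{u, v} ι) (γ₀ : C.env) (γm : ι → C.env) (out : ι × ι → ι × C.env),
      C.history [] = Pi.single γ₀ 1 ∧ (∀ l, C.Moves (l, γ₀) (x₀, γm l)) ∧
      (∀ i l, C.Moves (i, γm l) (out (i, l))) ∧ Function.Injective out ∧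
      (out p₀).2 = γ₀ ∧ (out p₀').2 = γ₀ ∧
      ∀ p p', (out p).1 = (out p₀).1 → (out p').1 = (out p₀').1 → (out p).2 = (out p').2 →
        p = p₀ ∧ p' = p₀' := by
  obtain ⟨out, hinj, h₀, h₀', hout⟩ := exists_labelling p₀ p₀'
  -- A state `inl l` stores the first output, `inr` carries a final label, and `inr none` is also
  -- the initial state.
  let f : ι × (ι ⊕ Option (ι × ι)) → ι × (ι ⊕ Option (ι × ι)) := fun s =>
    match s.2 with
    | .inl l => ((out (s.1, l)).1, .inr (out (s.1, l)).2)
    | .inr _ => (x₀, .inl s.1)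
  -- `f` forgets the label under `inr`, so it is injective only once the labels `some p` are
  -- excluded.
  let s : Set (ι × (ι ⊕ Option (ι × ι))) := {s | ∀ p, s.2 ≠ .inr (some p)}
  have hf : Set.InjOn f s := by
    rintro ⟨y, l | _ | p⟩ h ⟨y', l' | _ | p'⟩ h' e
    · simp only [f, Prod.mk.injEq, Sum.inr.injEq] at e
      have := hinj (Prod.ext e.1 e.2)
      simp_all
    · simp [f] at e
    · exact absurd rfl (h' p')
    · simp [f] at e
    · simpa [f] using e
    · exact absurd rfl (h' p')
    all_goals exact absurd rfl (h p)
  obtain ⟨C, e, he, hε, hC⟩ := PurifiedChannel.exists_moves.{u, v} (.inr none) hf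
  have he' : Function.Injective fun m => e (.inr m) := he.comp Sum.inr_injective
  refine ⟨C, e (.inr none), fun l => e (.inl l), fun p => ((out p).1, e (.inr (out p).2)), hε,
    fun l => ?_, fun i l => ?_, fun p p' h => ?_, congrArg (e <| .inr ·) h₀,
    congrArg (e <| .inr ·) h₀', fun p p' h h' hm => ?_⟩
  · simpa [f] using hC (l, .inr none) (by simp [s])
  · simpa [f] using hC (i, .inl l) (by simp [s])
  · simp only [Prod.mk.injEq] at h
    exact hinj (Prod.ext h.1 (he' h.2))
  · exact hout p p' h h' (he' hm)

end Memories

/-! ### Distinguishing contexts -/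

namespace Context

variable {ι : Type u} [Fintype ι] [DecidableEq ι]

/-- The context in which vertical particles cross the hole once and horizontal ones bypass it. -/
def controlled : Context.{u, v} ι 1 :=
  .trace (n := 1) (.compLeft .pbs (.parLeft .wire .hole))

/-- The context in which vertical particles cross `B`, the hole and `C`, twice in this order, and
horizontal ones bypass them. -/
def twice (B C : PurifiedChannel.{u, v} ι) : Context.{u, v} ι 1 :=
  .trace (n := 1) (.compLeft .pbs (.parLeft .wire (.compLeft .neg (.compLeft (.gate C)
    (.compRight .hole (.gate B))))))

end Context

namespace BareDiagram

variable {ι : Type u} [Fintype ι] [DecidableEq ι]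

/-- Bare forms of the two contexts: they are independent of the filling, so their runs compute by
`rfl`. -/
def controlled : BareDiagram 1 :=
  .trace (n := 1) (.comp .pbs (.par .wire .gate))

def twice : BareDiagram 1 :=
  .trace (n := 1) (.comp .pbs (.par .wire (.comp .neg (.comp .gate (.comp .gate .gate)))))

def controlledHole : controlled.Gate := Sum.inl (Sum.inr ())

def twiceFirst : twice.Gate := Sum.inl (Sum.inr (Sum.inl (Sum.inl (Sum.inl ()))))

def twiceHole : twice.Gate := Sum.inl (Sum.inr (Sum.inl (Sum.inl (Sum.inr ()))))

def twiceLast : twice.Gate := Sum.inl (Sum.inr (Sum.inl (Sum.inr ())))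

theorem run_controlled_ver : controlled.run (Pol.ver, 0) = ([controlledHole], (Pol.ver, 0)) := rfl

theorem run_controlled_hor : controlled.run (Pol.hor, 0) = ([], (Pol.hor, 0)) := rfl

/-- The PBS sends the vertical particle into the loop. After one round the negation makes it
horizontal, so the PBS keeps it there; after the second it is vertical again and leaves. -/
theorem run_twice_ver : twice.run (Pol.ver, 0) =
    ([twiceFirst, twiceHole, twiceLast, twiceFirst, twiceHole, twiceLast], (Pol.ver, 0)) := rfl

theorem run_twice_hor : twice.run (Pol.hor, 0) = ([], (Pol.hor, 0)) := rfl

/-- The family of the gates of `Context.controlled`. -/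
def controlledFamily (P : PurifiedChannel.{u, v} ι) : controlled.Gate → PurifiedChannel.{u, v} ι :=
  (Context.controlled.subst P).family

/-- The family of the gates of `Context.twice`. -/
def twiceFamily (B C P : PurifiedChannel.{u, v} ι) : twice.Gate → PurifiedChannel.{u, v} ι :=
  ((Context.twice B C).subst P).family

theorem envGram_controlled (P : PurifiedChannel.{u, v} ι) (i j : ι) :
    envGram (controlledFamily P) (wordState _ [controlledHole] j) (wordState _ [] i) i i =
      P.historyGram [(i, j)] [] := by
  rw [wordState, wordState, wordOperator_nil_mulVec, wordOperator_cons_mulVec_prodState,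
    envGram_sum_left, Finset.sum_eq_single i _ (by simp)]
  · rw [wordOperator_nil_mulVec, envGram_prodState, if_pos ⟨rfl, rfl⟩,
      Finset.prod_eq_single controlledHole _ (by simp)]
    · simp only [Function.update_self]
      rfl
    · intro g _ hg
      simp only [Function.update_of_ne hg]
      exact PurifiedChannel.historyGram_nil _
  · intro l _ hl
    rw [wordOperator_nil_mulVec, envGram_prodState, if_neg fun h => hl h.1.symm]

end BareDiagram

/-! ### Recovering the invariants from observational equivalence. -/

namespace ObsEquiv₂

variable {ι : Type u} [Fintype ι] [DecidableEq ι] {P Q : PurifiedChannel.{u, v} ι}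

open BareDiagram

theorem T₁_eq (h : ObsEquiv₂ P Q) : P.T₁ = Q.T₁ := by
  rw [PurifiedChannel.T₁_eq_iff]
  rintro ⟨i, j⟩
  have hs : controlled.semantics (controlledFamily P) = controlled.semantics (controlledFamily Q) :=
    h Context.controlled
  have := semantics_eq_iff.mp hs (Pol.ver, 0) (Pol.hor, 0) j i i i
  simp only [run_controlled_ver, run_controlled_hor] at this
  rwa [envGram_controlled, envGram_controlled] at this

theorem historyGram_eq (h : ObsEquiv₂ P Q) (i j k l i' j' k' l' : ι) :
    P.historyGram [(i, k), (l, j)] [(i', k'), (l', j')] =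
        Q.historyGram [(i, k), (l, j)] [(i', k'), (l', j')] ∧
      P.historyGram [(i, k), (l, j)] [] = Q.historyGram [(i, k), (l, j)] [] := by
  -- The final `j` is the data value that `C` hands to `B` between the two rounds; any value works
  -- if both memories share it.
  obtain ⟨B, β₀, βm, x, x', hβ, hb, hb', hb₂⟩ := exists_input_memory.{u, v} (j, k) (j', k') j
  obtain ⟨C, γ₀, γm, out, hγ, hc₁, hc₂, hinj, h₀, h₀', hout⟩ :=
    exists_output_memory.{u, v} (i, l) (i', l') j
  have hs : twice.semantics (twiceFamily B C P) = twice.semantics (twiceFamily B C Q) :=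
    h (Context.twice B C)
  have hab : twiceHole ≠ twiceFirst := by decide
  have hac : twiceHole ≠ twiceLast := by decide
  have hbc : twiceFirst ≠ twiceLast := by decide
  have hw : ∀ R : PurifiedChannel.{u, v} ι, wordState (twiceFamily B C R)
      [twiceFirst, twiceHole, twiceLast, twiceFirst, twiceHole, twiceLast] x = _ := fun R =>
    wordState_two_memories (G := twiceFamily B C R) hab hac hbc hβ hγ hb (hb₂ k) hc₁ hc₂
  have hw' : ∀ R : PurifiedChannel.{u, v} ι, wordState (twiceFamily B C R)
      [twiceFirst, twiceHole, twiceLast, twiceFirst, twiceHole, twiceLast] x' = _ := fun R =>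
    wordState_two_memories (G := twiceFamily B C R) hab hac hbc hβ hγ hb' (hb₂ k') hc₁ hc₂
  -- Two vertical inputs compare two double uses, for `S₂`; the vertical and horizontal pair below
  -- compares a double use with none, for `T₂`.
  have hs₂ := semantics_eq_iff.mp hs (Pol.ver, 0) (Pol.ver, 0) x x' (out (i, l)).1 (out (i', l')).1
  have ht₂ := semantics_eq_iff.mp hs (Pol.ver, 0) (Pol.hor, 0) x j (out (i, l)).1 j
  simp only [run_twice_ver, run_twice_hor] at hs₂ ht₂
  constructor
  · have key : ∀ R : PurifiedChannel.{u, v} ι, _ = R.historyGram _ _ := fun R =>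
      envGram_two_memories (G := twiceFamily B C R) (a := twiceHole)
        (b := twiceFirst) (c := twiceLast) (β₀ := β₀) hab hac hbc
        (F := fun p => R.history [(p.1, k), (p.2, j)])
        (F' := fun p => R.history [(p.1, k'), (p.2, j')]) (h₀.trans h₀'.symm) hout
    rw [hw, hw', hw, hw'] at hs₂
    exact (key P).symm.trans (hs₂.trans (key Q))
  · have key : ∀ R : PurifiedChannel.{u, v} ι, _ = R.historyGram _ _ := fun R =>
      envGram_two_memories_nil (G := twiceFamily B C R) (a := twiceHole)
        (b := twiceFirst) (c := twiceLast) (β₀ := β₀) hab hac hbc hβ hγ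
        (F := fun p => R.history [(p.1, k), (p.2, j)]) hinj h₀ j
    rw [hw, hw] at ht₂
    exact (key P).symm.trans (ht₂.trans (key Q))

theorem S₂_eq (h : ObsEquiv₂ P Q) : P.S₂ = Q.S₂ :=
  (PurifiedChannel.S₂_eq_iff P Q).mpr fun _ _ _ _ => (h.historyGram_eq ..).1

theorem T₂_eq (h : ObsEquiv₂ P Q) : P.T₂ = Q.T₂ :=
  (PurifiedChannel.T₂_eq_iff P Q).mpr fun p q =>
    (h.historyGram_eq p.1 q.2 p.2 q.1 p.1 q.2 p.2 q.1).2

end ObsEquiv₂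

theorem mainTheorem1 {ι : Type u} [Fintype ι] [DecidableEq ι] (P Q : PurifiedChannel.{u, v} ι) :
    (ObsEquiv₂ P Q ↔ P.T₁ = Q.T₁ ∧ P.S₂ = Q.S₂ ∧ P.T₂ = Q.T₂) ∧
      (ObsEquiv₂ P Q ↔ ∀ (n : ℕ) (C : Context.{u, v} ι n),
        (C.subst P).semantics = (C.subst Q).semantics) := by
  have h : ObsEquiv₂ P Q → P.T₁ = Q.T₁ ∧ P.S₂ = Q.S₂ ∧ P.T₂ = Q.T₂ :=
    fun h => ⟨h.T₁_eq, h.S₂_eq, h.T₂_eq⟩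
  have h' : P.T₁ = Q.T₁ ∧ P.S₂ = Q.S₂ ∧ P.T₂ = Q.T₂ → ∀ (n : ℕ) (C : Context.{u, v} ι n),
      (C.subst P).semantics = (C.subst Q).semantics :=
    fun h _ C => C.semantics_subst_congr h.1 h.2.1 h.2.2
  exact ⟨⟨h, fun hPQ => h' hPQ 1⟩, ⟨fun hPQ => h' (h hPQ), fun hC => hC 1⟩⟩
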